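/- Notation. For a complex Hilbert space $H$ let $\mathcal F(H)=\mathbf C\Omega\oplus\bigoplus_{n\ge 1}H^{\otimes n}$ be the full Fock space with vacuum vector $\Omega$, for $\xi\in H$ let $\ell(\xi)$ be the left creation operator on $\mathcal F(H)$, so $\ell(\xi)\Omega=\xi$ and $\ell(\xi)(\xi_1\otimes\cdots\otimes\xi_n)=\xi\otimes\xi_1\otimes\cdots\otimes\xi_n$, and let $\mathcal T(H)\subset\mathbf B(\mathcal F(H))$ be the unital $C^*$-algebra generated by all $\ell(\xi)$, $\xi\in H$. For a contraction $T:H\to K$ (a linear map with $\|T\|\le 1$) put $\tilde\Gamma(T)=1\oplus\bigoplus_{n\ge1}T^{\otimes n}:\mathcal F(H)\to\mathcal F(K)$. (1) Let $H,K$ be complex Hilbert spaces and $T:H\to K$ a contraction. Then there is a unique unital completely positive map $\Gamma(T):\mathcal T(H)\to\mathcal T(K)$ such that $$\Gamma(T)\big(\ell(h_1)\cdots\ell(h_k)\,\ell(h_{k+1})^*\cdots\ell(h_n)^*\big)=\ell(Th_1)\cdots\ell(Th_k)\,\ell(Th_{k+1})^*\cdots\ell(Th_n)^*$$ for all $0\le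 k\le n$ and all $h_1,\dots,h_n\in H$. (2) Let $H_{\mathbf R}$ be a real Hilbert space, $(U_t)_{t\in\mathbf R}$ a strongly continuous orthogonal representation of $\mathbf R$ on $H_{\mathbf R}$, $H=H_{\mathbf R}\otimes_{\mathbf R}\mathbf C$ the complexification with conjugation $J(\xi+i\eta)=\xi-i\eta$, and $A$ the positive nonsingular self-adjoint operator on $H$ with $U_t=A^{it}$. Let $I=JA^{-1/2}$, with domain $\operatorname{dom}(A^{-1/2})$, let $K_{\mathbf R}=\{\xi\in\operatorname{dom}(I): I\xi=\xi\}$ and $s(\xi)=\frac12(\ell(\xi)+\ell(\xi)^*)$. Let $\Gamma(H_{\mathbf R},U_t)$ be the unital $C^*$-algebra and $\Gamma(H_{\mathbf R},U_t)''$ the von Neumann algebra (the free Araki–Woods algebra) generated by $\{s(\xi):\xi\in K_{\mathbf R}\}$ on $\mathcal F(H)$. The vacuum vector is separating for $\Gamma(H_{\mathbf R},U_t)''$, so that for $\xi\in\Gamma(H_{\mathbf R},U_t)''\Omega$ there is a unique $W(\xi)\in\Gamma(H_{\mathbf R},U_t)''$ with $W(\xi)\Omega=\xi$. Let $T:H\to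 H$ be a contraction with $ITI=T$, i.e. for every $\xi\in\operatorname{dom}(I)$ one has $TI\xi\in\operatorname{dom}(I)$ and $ITI\xi=T\xi$. Then $\Gamma(T)$ maps $\Gamma(H_{\mathbf R},U_t)$ into itself, and its restriction to $\Gamma(H_{\mathbf R},U_t)$ extends to a normal completely positive map on $\Gamma(H_{\mathbf R},U_t)''$, again denoted $\Gamma(T)$, such that for every $\xi\in\Gamma(H_{\mathbf R},U_t)''\Omega$ the vector $\tilde\Gamma(T)\xi$ lies in $\Gamma(H_{\mathbf R},U_t)''\Omega$ and $$\Gamma(T)W(\xi)=W(\tilde\Gamma(T)\xi).$$ -/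

import Mathlib

open scoped TensorProduct InnerProductSpace ComplexConjugate

noncomputable section

universe u v

namespace ArakiWoods

/-! ### Complexification of a real Hilbert space -/

/-- The complexification `V ⊗_ℝ ℂ` of a real inner product space `V`: pairs `(x, y)`, read as
`x + i y`, with the `ℓ²` norm `‖x + i y‖² = ‖x‖² + ‖y‖²`. -/
def Complexified (V : Type u) : Type u := WithLp 2 (V × V)

namespace Complexified

section

variable {V : Type u}

/-- The vector `x + i y`. -/
def mk (x y : V) : Complexified V := WithLp.toLp 2 (x, y)

/-- The real part of `x + i y`. -/
def re (z : Complexified V) : V := WithLp.fst (p := 2) z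

/-- The imaginary part of `x + i y`. -/
def im (z : Complexified V) : V := WithLp.snd (p := 2) z

@[simp] theorem re_mk (x y : V) : (mk x y).re = x := rfl

@[simp] theorem im_mk (x y : V) : (mk x y).im = y := rfl

@[ext] theorem ext {z w : Complexified V} (h₁ : z.re = w.re) (h₂ : z.im = w.im) : z = w :=
  WithLp.ofLp_injective 2 (Prod.ext h₁ h₂)

end

section

variable {V : Type u} [NormedAddCommGroup V]

instance : NormedAddCommGroup (Complexified V) :=
  inferInstanceAs (NormedAddCommGroup (WithLp 2 (V × V)))

instance [CompleteSpace V] : CompleteSpace (Complexified V) :=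
  inferInstanceAs (CompleteSpace (WithLp 2 (V × V)))

theorem norm_sq_eq (z : Complexified V) : ‖z‖ ^ 2 = ‖z.re‖ ^ 2 + ‖z.im‖ ^ 2 :=
  WithLp.prod_norm_sq_eq_of_L2 (α := V) (β := V) z

@[simp] theorem re_zero : (0 : Complexified V).re = 0 := rfl
@[simp] theorem im_zero : (0 : Complexified V).im = 0 := rfl
@[simp] theorem re_add (z w : Complexified V) : (z + w).re = z.re + w.re := rfl
@[simp] theorem im_add (z w : Complexified V) : (z + w).im = z.im + w.im := rfl

end

variable {V : Type u} [NormedAddCommGroup V] [InnerProductSpace ℝ V]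

/-- `(a + i b) (x + i y) = (a x - b y) + i (b x + a y)`. -/
instance : SMul ℂ (Complexified V) where
  smul c z := mk (c.re • z.re - c.im • z.im) (c.im • z.re + c.re • z.im)

@[simp] theorem re_smul (c : ℂ) (z : Complexified V) :
    (c • z).re = c.re • z.re - c.im • z.im := rfl

@[simp] theorem im_smul (c : ℂ) (z : Complexified V) :
    (c • z).im = c.im • z.re + c.re • z.im := rfl

instance : Module ℂ (Complexified V) where
  one_smul z := by ext <;> simp
  mul_smul a b z := by
    ext <;> simp [smul_sub, smul_add, sub_smul, add_smul, mul_smul] <;> abel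
  smul_zero a := by ext <;> simp
  smul_add a z w := by ext <;> simp <;> abel
  add_smul a b z := by ext <;> simp [add_smul] <;> abel
  zero_smul z := by ext <;> simp

/-- `⟪x + i y, x' + i y'⟫ = ⟪x, x'⟫ + ⟪y, y'⟫ + i (⟪x, y'⟫ - ⟪y, x'⟫)`, conjugate-linear in the
first variable. -/
instance : Inner ℂ (Complexified V) where
  inner z w := ⟨⟪z.re, w.re⟫_ℝ + ⟪z.im, w.im⟫_ℝ, ⟪z.re, w.im⟫_ℝ - ⟪z.im, w.re⟫_ℝ⟩

theorem inner_def (z w : Complexified V) : inner ℂ z w =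
    ⟨⟪z.re, w.re⟫_ℝ + ⟪z.im, w.im⟫_ℝ, ⟪z.re, w.im⟫_ℝ - ⟪z.im, w.re⟫_ℝ⟩ := rfl

theorem norm_smul_eq (c : ℂ) (z : Complexified V) : ‖c • z‖ = ‖c‖ * ‖z‖ := by
  have h : ‖c • z‖ ^ 2 = (‖c‖ * ‖z‖) ^ 2 := by
    rw [mul_pow, norm_sq_eq, norm_sq_eq z, Complex.sq_norm, Complex.normSq_apply, re_smul, im_smul,
      norm_sub_sq_real, norm_add_sq_real]
    simp only [norm_smul, mul_pow, Real.norm_eq_abs, sq_abs, inner_smul_left, inner_smul_right,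
      RCLike.conj_to_real]
    ring
  exact (sq_eq_sq₀ (norm_nonneg _) (by positivity)).1 h

instance : InnerProductSpace ℂ (Complexified V) where
  norm_smul_le c z := (norm_smul_eq c z).le
  norm_sq_eq_re_inner z := by
    rw [norm_sq_eq, inner_def]
    simp
  conj_inner_symm z w := by
    apply Complex.ext
    · simp [inner_def, real_inner_comm]
    · simp [inner_def, real_inner_comm]
  add_left z w y := by
    apply Complex.ext
    · simp [inner_def, inner_add_left]; ring
    · simp [inner_def, inner_add_left]; ring
  smul_left z w c := by
    apply Complex.ext
    · simp [inner_def, inner_add_left, inner_sub_left, inner_smul_left]; ring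
    · simp [inner_def, inner_add_left, inner_sub_left, inner_smul_left]; ring

/-- The canonical conjugation `J (x + i y) = x - i y`. -/
def conjugation (V : Type u) [NormedAddCommGroup V] [InnerProductSpace ℝ V] :
    Complexified V →ₗ⋆[ℂ] Complexified V where
  toFun z := mk z.re (-z.im)
  map_add' z w := by ext <;> simp; abel
  map_smul' c z := by ext <;> simp; abel

/-- The complex-linear extension `x + i y ↦ f x + i f y` of a real-linear map. -/
def map (f : V →ₗ[ℝ] V) : Complexified V →ₗ[ℂ] Complexified V where
  toFun z := mk (f z.re) (f z.im)
  map_add' z w := by ext <;> simp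
  map_smul' c z := by ext <;> simp

end Complexified

/-! ### The full Fock space -/

/-- A bundled complex Hilbert space, used to define the tensor powers by recursion. -/
structure Hilb : Type (u + 1) where
  /-- The underlying space. -/
  carrier : Type u
  [normed : NormedAddCommGroup carrier]
  [inner : InnerProductSpace ℂ carrier]
  [complete : CompleteSpace carrier]

attribute [instance] Hilb.normed Hilb.inner Hilb.complete

/-- A one-dimensional Hilbert space, i.e. a copy of `ℂ` in the universe `u`. -/
abbrev Scalars : Type u := EuclideanSpace ℂ PUnit.{u + 1}

/-- The identity of `ℂ`, between copies of `ℂ` in two universes. -/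
def scalarsMap : Scalars.{u} →L[ℂ] Scalars.{v} :=
  (EuclideanSpace.proj PUnit.unit).smulRight (EuclideanSpace.single PUnit.unit (1 : ℂ))

theorem norm_scalarsMap_le : ‖scalarsMap.{u, v}‖ ≤ 1 := by
  refine ContinuousLinearMap.opNorm_le_bound _ zero_le_one fun x => ?_
  change ‖x PUnit.unit • (EuclideanSpace.single PUnit.unit (1 : ℂ) : Scalars.{v})‖ ≤ _
  rw [norm_smul]
  simpa using PiLp.norm_apply_le x PUnit.unit

variable (H : Type u) [NormedAddCommGroup H] [InnerProductSpace ℂ H]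

/-- The Hilbert space tensor powers `H^{⊗ n}`: the power `H^{⊗ 0}` is a one-dimensional space, and
`H^{⊗ (n+1)}` is the completion of the algebraic tensor product `H ⊗ H^{⊗ n}` for the inner product
`⟪a ⊗ b, c ⊗ d⟫ = ⟪a, c⟫ ⟪b, d⟫`. -/
def tensorPower : ℕ → Hilb.{u}
  | 0 => ⟨Scalars.{u}⟩
  | n + 1 => ⟨UniformSpace.Completion (H ⊗[ℂ] (tensorPower n).carrier)⟩

/-- The space `H^{⊗ n}`. -/
abbrev TPow (n : ℕ) : Type u := (tensorPower H n).carrier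

/-- The full Fock space, i.e. the Hilbert space direct sum of the `H^{⊗ n}`, `n ≥ 0`. -/
def Fock : Type u := lp (TPow H) 2

instance : NormedAddCommGroup (Fock H) := inferInstanceAs (NormedAddCommGroup (lp (TPow H) 2))

instance : InnerProductSpace ℂ (Fock H) := inferInstanceAs (InnerProductSpace ℂ (lp (TPow H) 2))

instance : CompleteSpace (Fock H) := inferInstanceAs (CompleteSpace (lp (TPow H) 2))

/-- The unit vector `1` of `H^{⊗ 0} = ℂ`. -/
def vacuumZero : TPow H 0 := (EuclideanSpace.single PUnit.unit (1 : ℂ) : Scalars.{u})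

/-- The vacuum vector `Ω`, the unit vector of `H^{⊗ 0}`. -/
def vacuum : Fock H := (lp.single 2 0 (vacuumZero H) : lp (TPow H) 2)

variable {H}

/-- `x ↦ ξ ⊗ x`, from `H^{⊗ n}` to `H^{⊗ (n+1)}`. -/
def tensorLeft (ξ : H) (n : ℕ) : TPow H n →L[ℂ] TPow H (n + 1) :=
  (UniformSpace.Completion.toComplL (𝕜 := ℂ) (E := H ⊗[ℂ] TPow H n)).comp
    (TensorProduct.mkL ℂ H (TPow H n) ξ)

theorem norm_tensorLeft_apply (ξ : H) (n : ℕ) (x : TPow H n) :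
    ‖tensorLeft ξ n x‖ = ‖ξ‖ * ‖x‖ :=
  (UniformSpace.Completion.norm_coe (ξ ⊗ₜ[ℂ] x)).trans (TensorProduct.norm_tmul ξ x)

/-- The sequence of components of `ℓ(ξ) x`. -/
def creationFun (ξ : H) (x : lp (TPow H) 2) : ∀ n, TPow H n
  | 0 => 0
  | n + 1 => tensorLeft ξ n (x n)

theorem hasSum_creationFun (ξ : H) (x : lp (TPow H) 2) :
    HasSum (fun n => ‖creationFun ξ x n‖ ^ 2) (‖ξ‖ ^ 2 * ‖x‖ ^ 2) := by
  have h : HasSum (fun n => ‖x n‖ ^ 2) (‖x‖ ^ 2) := by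
    have := lp.hasSum_norm (p := 2) (by norm_num) x
    simpa using this
  refine (hasSum_nat_add_iff' 1).1 ?_
  simpa [creationFun, norm_tensorLeft_apply, mul_pow] using h.mul_left (‖ξ‖ ^ 2)

/-- The left creation operator: `ℓ(ξ) Ω = ξ`, `ℓ(ξ) (ξ₁ ⊗ ⋯ ⊗ ξₙ) = ξ ⊗ ξ₁ ⊗ ⋯ ⊗ ξₙ`. -/
def creation (ξ : H) : Fock H →L[ℂ] Fock H :=
  show lp (TPow H) 2 →L[ℂ] lp (TPow H) 2 from
  LinearMap.mkContinuous
    { toFun := fun x => ⟨creationFun ξ x, memℓp_gen (by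
        simpa using (hasSum_creationFun ξ x).summable)⟩
      map_add' := fun x y => by
        refine lp.ext (funext fun n => ?_)
        cases n with
        | zero => exact (add_zero (0 : TPow H 0)).symm
        | succ n => exact map_add (tensorLeft ξ n) (x n) (y n)
      map_smul' := fun c x => by
        refine lp.ext (funext fun n => ?_)
        cases n with
        | zero => exact (smul_zero c : c • (0 : TPow H 0) = 0).symm
        | succ n => exact map_smul (tensorLeft ξ n) c (x n) }
    ‖ξ‖ fun x => by
      refine (sq_le_sq₀ (norm_nonneg _) (by positivity)).1 (le_of_eq ?_)
      rw [mul_pow]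
      refine HasSum.unique ?_ (hasSum_creationFun ξ x)
      have := lp.hasSum_norm (p := 2) (by norm_num)
        (⟨creationFun ξ x, memℓp_gen (by
          simpa using (hasSum_creationFun ξ x).summable)⟩ : lp (TPow H) 2)
      simpa using this

variable {K : Type v} [NormedAddCommGroup K] [InnerProductSpace ℂ K]

/-- The tensor powers `T^{⊗ n} : H^{⊗ n} → K^{⊗ n}`, with `T^{⊗ 0}` the identity of `ℂ`. -/
def mapPower (T : H →L[ℂ] K) : ∀ n, TPow H n →L[ℂ] TPow K n
  | 0 => scalarsMap.{u, v}
  | n + 1 => (TensorProduct.mapL T (mapPower T n)).completion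

theorem norm_completion_le {E F : Type*} [NormedAddCommGroup E] [NormedSpace ℂ E]
    [NormedAddCommGroup F] [NormedSpace ℂ F] (f : E →L[ℂ] F) : ‖f.completion‖ ≤ ‖f‖ := by
  refine ContinuousLinearMap.opNorm_le_bound _ (norm_nonneg _) fun x => ?_
  induction x using UniformSpace.Completion.induction_on with
  | hp => exact isClosed_le (by fun_prop) (by fun_prop)
  | ih x => simpa using f.le_opNorm x

theorem norm_mapPower_le (T : H →L[ℂ] K) (hT : ‖T‖ ≤ 1) (n : ℕ) : ‖mapPower T n‖ ≤ 1 := by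
  induction n with
  | zero => exact norm_scalarsMap_le
  | succ n ih =>
    refine (norm_completion_le _).trans ((TensorProduct.norm_mapL_le _ _).trans ?_)
    exact mul_le_one₀ hT (norm_nonneg _) ih

/-- The first quantization `1 ⊕ ⨁_{n ≥ 1} T^{⊗ n}` of a contraction `T`. -/
def firstQuantization (T : H →L[ℂ] K) (hT : ‖T‖ ≤ 1) : Fock H →L[ℂ] Fock K :=
  show lp (TPow H) 2 →L[ℂ] lp (TPow K) 2 from lp.mapCLM 2 (fun n => mapPower T n) zero_le_one (norm_mapPower_le T hT)

/-! ### Operator algebras -/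

section OperatorAlgebras

variable {E : Type u} [NormedAddCommGroup E] [InnerProductSpace ℂ E] [CompleteSpace E]

/-- The unital C⋆-algebra of operators generated by a set. -/
def cstarGenerated (S : Set (E →L[ℂ] E)) : StarSubalgebra ℂ (E →L[ℂ] E) :=
  (StarAlgebra.adjoin ℂ S).topologicalClosure

instance (S : Set (E →L[ℂ] E)) : IsClosed (cstarGenerated S : Set (E →L[ℂ] E)) :=
  StarSubalgebra.isClosed_topologicalClosure _

theorem subset_cstarGenerated (S : Set (E →L[ℂ] E)) : S ⊆ cstarGenerated S :=
  (StarAlgebra.subset_adjoin ℂ S).trans (StarSubalgebra.le_topologicalClosure _)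

/-- The von Neumann algebra generated by a set, i.e. the double commutant of `S ∪ S*`. -/
def vonNeumannGenerated (S : Set (E →L[ℂ] E)) : VonNeumannAlgebra E where
  toStarSubalgebra := StarSubalgebra.centralizer ℂ (StarSubalgebra.centralizer ℂ S : Set _)
  centralizer_centralizer' := by
    have h := StarSubalgebra.coe_centralizer_centralizer ℂ S
    change Set.centralizer (Set.centralizer
      ((StarSubalgebra.centralizer ℂ (StarSubalgebra.centralizer ℂ S : Set (E →L[ℂ] E)) :
        StarSubalgebra ℂ (E →L[ℂ] E)) : Set (E →L[ℂ] E))) =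
      ((StarSubalgebra.centralizer ℂ (StarSubalgebra.centralizer ℂ S : Set (E →L[ℂ] E)) :
        StarSubalgebra ℂ (E →L[ℂ] E)) : Set (E →L[ℂ] E))
    rw [h]
    simp

instance (S : Set (E →L[ℂ] E)) :
    IsClosed ((vonNeumannGenerated S).toStarSubalgebra : Set (E →L[ℂ] E)) :=
  Set.isClosed_centralizer _

theorem cstarGenerated_le_vonNeumannGenerated (S : Set (E →L[ℂ] E)) :
    cstarGenerated S ≤ (vonNeumannGenerated S).toStarSubalgebra :=
  StarSubalgebra.topologicalClosure_minimal
    (StarAlgebra.adjoin_le_centralizer_centralizer ℂ S) (Set.isClosed_centralizer _)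

/-- The `σ`-weak (ultraweak) topology on `B(E)`: the coarsest topology for which all the functionals
`x ↦ ∑ n, ⟪ξₙ, x ηₙ⟫`, with `(ξₙ)` and `(ηₙ)` square summable, are continuous. -/
@[reducible] def sigmaWeak (E : Type u) [NormedAddCommGroup E] [InnerProductSpace ℂ E] :
    TopologicalSpace (E →L[ℂ] E) :=
  ⨅ (ξ : lp (fun _ : ℕ => E) 2) (η : lp (fun _ : ℕ => E) 2),
    TopologicalSpace.induced (fun x : E →L[ℂ] E => ∑' n, inner ℂ (ξ n) (x (η n))) inferInstance

/-- A map between von Neumann algebras is normal if it is continuous for the `σ`-weak topologies. -/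
def IsNormal {F : Type v} [NormedAddCommGroup F] [InnerProductSpace ℂ F] [CompleteSpace F]
    {M : VonNeumannAlgebra E} {N : VonNeumannAlgebra F}
    (Φ : M.toStarSubalgebra → N.toStarSubalgebra) : Prop :=
  @Continuous _ _ ((sigmaWeak E).induced Subtype.val) ((sigmaWeak F).induced Subtype.val) Φ

end OperatorAlgebras

/-- Completely positive maps between C⋆-algebras, each ordered by its cone of positive elements. -/
abbrev CPMap (A : Type u) (B : Type v) [CStarAlgebra A] [CStarAlgebra B] : Type (max u v) :=
  @CompletelyPositiveMap A B _ _ (CStarAlgebra.spectralOrder A) (CStarAlgebra.spectralOrder B)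
    (CStarAlgebra.spectralOrderedRing A) (CStarAlgebra.spectralOrderedRing B)

/-! ### The Toeplitz algebra and second quantization -/

variable (H) in
/-- The Toeplitz algebra `𝒯(H)`, the C⋆-algebra generated by the left creation operators. -/
def toeplitz : StarSubalgebra ℂ (Fock H →L[ℂ] Fock H) :=
  cstarGenerated (Set.range (creation (H := H)))

instance : IsClosed (toeplitz H : Set (Fock H →L[ℂ] Fock H)) :=
  StarSubalgebra.isClosed_topologicalClosure _

/-- The creation operator `ℓ(ξ)` as an element of `𝒯(H)`. -/
def toeplitzCreation (ξ : H) : toeplitz H :=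
  ⟨creation ξ, subset_cstarGenerated _ (Set.mem_range_self ξ)⟩

/-- The element `ℓ(h₁) ⋯ ℓ(h_k) ℓ(h_{k+1})* ⋯ ℓ(h_n)*` of `𝒯(H)`, for `a = [h₁, …, h_k]` and
`b = [h_{k+1}, …, h_n]`. -/
def wickWord (a b : List H) : toeplitz H :=
  (a.map toeplitzCreation).prod * (b.map fun h => star (toeplitzCreation h)).prod

/-- `G` is a second quantization `Γ(T)` of `T`: a unital completely positive map `𝒯(H) → 𝒯(K)` that
applies `T` to each letter of the words `ℓ(h₁) ⋯ ℓ(h_k) ℓ(h_{k+1})* ⋯ ℓ(h_n)*`. -/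
structure IsSecondQuantization (T : H →L[ℂ] K) (G : CPMap (toeplitz H) (toeplitz K)) : Prop where
  map_one : G 1 = 1
  map_word : ∀ a b : List H, G (wickWord a b) = wickWord (a.map T) (b.map T)

/-! ### Free Araki–Woods algebras -/

/-- For a one-parameter unitary group `u t = A^{i t}`, the graph of `A^{-s}`, `s > 0`: a vector `ξ`
is in the domain of `A^{-s}` if and only if the function `i t ↦ u (-t) ξ = A^{-i t} ξ` on the
imaginary axis extends to a bounded continuous function `F` on the strip `0 ≤ re z ≤ s` (namely
`F z = A^{-z} ξ`) which is holomorphic in the interior, and then `A^{-s} ξ = F s`. -/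
def negPowGraph (u : ℝ → H →ₗ[ℂ] H) (s : ℝ) : Submodule ℂ (H × H) where
  carrier := {p | ∃ F : ℂ → H, DiffContOnCl ℂ F (Complex.re ⁻¹' Set.Ioo 0 s) ∧
    BddAbove ((norm ∘ F) '' (Complex.re ⁻¹' Set.Icc 0 s)) ∧
    (∀ t : ℝ, F (t * Complex.I) = u (-t) p.1) ∧ F s = p.2}
  zero_mem' := ⟨0, diffContOnCl_const, ⟨0, by rintro _ ⟨z, -, rfl⟩; simp⟩, by simp, by simp⟩
  add_mem' := by
    rintro p q ⟨F, hF, ⟨C, hC⟩, hF', hF''⟩ ⟨G, hG, ⟨D, hD⟩, hG', hG''⟩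
    refine ⟨F + G, hF.add hG, ⟨C + D, ?_⟩, by simp [hF', hG'], by simp [hF'', hG'']⟩
    rintro _ ⟨z, hz, rfl⟩
    exact (norm_add_le _ _).trans
      (add_le_add (hC (Set.mem_image_of_mem _ hz)) (hD (Set.mem_image_of_mem _ hz)))
  smul_mem' := by
    rintro c p ⟨F, hF, ⟨C, hC⟩, hF', hF''⟩
    refine ⟨c • F, hF.const_smul c, ⟨‖c‖ * C, ?_⟩, by simp [hF'], by simp [hF'']⟩
    rintro _ ⟨z, hz, rfl⟩
    exact (norm_smul_le _ _).trans
      (mul_le_mul_of_nonneg_left (hC (Set.mem_image_of_mem _ hz)) (norm_nonneg _))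

/-- The relation `negPowGraph u s` is the graph of an operator. -/
theorem negPowGraph_eq_zero (u : ℝ → H →ₗ[ℂ] H) {s : ℝ} (hs : 0 < s) {p : H × H}
    (hp : p ∈ negPowGraph u s) (hp0 : p.1 = 0) : p.2 = 0 := by
  obtain ⟨F, hF, hB, hF0, hFs⟩ := hp
  obtain ⟨C, hC⟩ := id hB
  have h0 : ∀ z ∈ Complex.re ⁻¹' {(0 : ℝ)}, ‖F z‖ ≤ 0 := by
    intro z hz
    have : z = (z.im : ℂ) * Complex.I := by
      apply Complex.ext <;> simp [show z.re = 0 from hz]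
    rw [this, hF0, hp0]
    simp
  have h1 : ∀ z ∈ Complex.re ⁻¹' {s}, ‖F z‖ ≤ C := fun z hz =>
    hC ⟨z, by simp [show z.re = s from hz, hs.le], rfl⟩
  have key : ∀ x : ℝ, x ∈ Set.Ioo 0 s → F x = 0 := by
    intro x hx
    have := Complex.HadamardThreeLines.norm_le_interp_of_mem_verticalClosedStrip' (z := (x : ℂ)) hs
      (by simpa [Complex.HadamardThreeLines.verticalClosedStrip] using ⟨hx.1.le, hx.2.le⟩)
      hF hB h0 h1
    rw [Real.zero_rpow, zero_mul] at this
    · simpa using this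
    · have : x / s < 1 := (div_lt_one hs).2 hx.2
      simp only [Complex.ofReal_re, sub_zero]
      linarith
  have hcl : closure (Complex.re ⁻¹' Set.Ioo 0 s) = Complex.re ⁻¹' Set.Icc 0 s := by
    rw [Complex.closure_preimage_re, closure_Ioo hs.ne]
  have hcont : ContinuousOn (fun x : ℝ => F x) (Set.Icc 0 s) := by
    refine hF.continuousOn.comp Complex.continuous_ofReal.continuousOn fun x hx => ?_
    rw [hcl]
    simpa using hx
  have : Set.EqOn (fun x : ℝ => F x) (fun _ => 0) (closure (Set.Ioo 0 s)) := by
    refine Set.EqOn.of_subset_closure (s := Set.Ioo 0 s) key ?_ continuousOn_const ?_ le_rfl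
    · rwa [closure_Ioo hs.ne]
    · exact subset_closure
  rw [← hFs]
  exact this (by rw [closure_Ioo hs.ne]; exact ⟨hs.le, le_rfl⟩)

/-- The operator `A^{-s}`, `s > 0`, where `u t = A^{i t}`. -/
def negPow (u : ℝ → H →ₗ[ℂ] H) (s : ℝ) : H →ₗ.[ℂ] H := (negPowGraph u s).toLinearPMap

section FreeArakiWoods

variable {V : Type u} [NormedAddCommGroup V] [InnerProductSpace ℝ V]

/-- The unitary group on `V ⊗_ℝ ℂ` that extends an orthogonal representation `U` of `ℝ` on `V`. -/
def unitaryGroup (U : Multiplicative ℝ →* (V ≃ₗᵢ[ℝ] V)) (t : ℝ) :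
    Complexified V →ₗ[ℂ] Complexified V :=
  Complexified.map (U (Multiplicative.ofAdd t)).toLinearEquiv.toLinearMap

/-- The operator `A^{-1/2}` on `V ⊗_ℝ ℂ`, where `U_t = A^{i t}`. -/
def invSqrtGenerator (U : Multiplicative ℝ →* (V ≃ₗᵢ[ℝ] V)) :
    Complexified V →ₗ.[ℂ] Complexified V :=
  negPow (unitaryGroup U) (1 / 2)

/-- The involution `I = J A^{-1/2}`, a conjugate-linear operator defined on the domain of
`A^{-1/2}`. -/
def involution (U : Multiplicative ℝ →* (V ≃ₗᵢ[ℝ] V)) :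
    (invSqrtGenerator U).domain →ₗ⋆[ℂ] Complexified V :=
  (Complexified.conjugation V).comp (invSqrtGenerator U).toFun

/-- The real subspace `K_ℝ = {ξ ∈ dom I : I ξ = ξ}`. -/
def realSubspace (U : Multiplicative ℝ →* (V ≃ₗᵢ[ℝ] V)) : Set (Complexified V) :=
  {ξ | ∃ h : ξ ∈ (invSqrtGenerator U).domain, involution U ⟨ξ, h⟩ = ξ}

/-- The relation `I T I = T` for a bounded operator `T`: for every `ξ` in the domain of `I`, the
vector `T I ξ` is in the domain of `I`, and `I T I ξ = T ξ`. -/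
def CommutesWithInvolution (U : Multiplicative ℝ →* (V ≃ₗᵢ[ℝ] V))
    (T : Complexified V →L[ℂ] Complexified V) : Prop :=
  ∀ ξ : (invSqrtGenerator U).domain,
    ∃ h : T (involution U ξ) ∈ (invSqrtGenerator U).domain,
      involution U ⟨T (involution U ξ), h⟩ = T ξ

/-- The real part `s(ξ) = (ℓ(ξ) + ℓ(ξ)*) / 2` of a creation operator. -/
def semicircular (ξ : Complexified V) : Fock (Complexified V) →L[ℂ] Fock (Complexified V) :=
  (1 / 2 : ℂ) • (creation ξ + star (creation ξ))

/-- The C⋆-algebra `Γ(V, U)` generated by the `s(ξ)`, `ξ ∈ K_ℝ`. -/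
def arakiWoodsCStar (U : Multiplicative ℝ →* (V ≃ₗᵢ[ℝ] V)) :
    StarSubalgebra ℂ (Fock (Complexified V) →L[ℂ] Fock (Complexified V)) :=
  cstarGenerated (semicircular '' realSubspace U)

/-- The free Araki–Woods von Neumann algebra `Γ(V, U)''`. -/
def arakiWoods (U : Multiplicative ℝ →* (V ≃ₗᵢ[ℝ] V)) :
    VonNeumannAlgebra (Fock (Complexified V)) :=
  vonNeumannGenerated (semicircular '' realSubspace U)

instance (U : Multiplicative ℝ →* (V ≃ₗᵢ[ℝ] V)) :
    IsClosed ((arakiWoods U).toStarSubalgebra :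
      Set (Fock (Complexified V) →L[ℂ] Fock (Complexified V))) :=
  Set.isClosed_centralizer _

theorem arakiWoodsCStar_le_arakiWoods (U : Multiplicative ℝ →* (V ≃ₗᵢ[ℝ] V)) :
    arakiWoodsCStar U ≤ (arakiWoods U).toStarSubalgebra :=
  cstarGenerated_le_vonNeumannGenerated _

theorem arakiWoodsCStar_le_toeplitz (U : Multiplicative ℝ →* (V ≃ₗᵢ[ℝ] V)) :
    arakiWoodsCStar U ≤ toeplitz (Complexified V) := by
  refine StarSubalgebra.topologicalClosure_minimal (StarAlgebra.adjoin_le ?_)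
    (inferInstanceAs (IsClosed (toeplitz (Complexified V) :
      Set (Fock (Complexified V) →L[ℂ] Fock (Complexified V)))))
  rintro _ ⟨ξ, -, rfl⟩
  have h : creation ξ ∈ toeplitz (Complexified V) := (toeplitzCreation ξ).2
  exact SMulMemClass.smul_mem _ (add_mem h (star_mem h))

/-- The map `x ↦ x Ω` from `Γ(V, U)''` to the Fock space. -/
def vacuumVector (U : Multiplicative ℝ →* (V ≃ₗᵢ[ℝ] V)) (x : (arakiWoods U).toStarSubalgebra) :
    Fock (Complexified V) :=
  (x : Fock (Complexified V) →L[ℂ] Fock (Complexified V)) (vacuum (Complexified V))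

/-- For `ξ ∈ Γ(V, U)'' Ω`, the element `W(ξ)` of `Γ(V, U)''` with `W(ξ) Ω = ξ`. -/
def wickOp (U : Multiplicative ℝ →* (V ≃ₗᵢ[ℝ] V)) (ξ : Fock (Complexified V)) :
    (arakiWoods U).toStarSubalgebra :=
  Function.invFun (vacuumVector U) ξ

end FreeArakiWoods

end ArakiWoods

end

open ArakiWoods

noncomputable section

universe u v w

/-! Everything is carried by one Stinespring dilation. With `D` chosen so that `D* D = 1 - T* T`,
the map `W ξ = (T ξ, D ξ)` is an isometry of `H` into `K ⊕ H`. The Fock space of `K ⊕ H` contains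
the Fock space of `K` through an isometry `j`, and `ℓ(W ξ)* j = j ℓ(T ξ)*`, since `W ξ` and `(η, 0)`
have inner product `⟪T ξ, η⟫`. On the other hand the operators `ℓ(W ξ)` form a row isometry without
residual part in its Wold decomposition (`exists_wold`), so the same space is a multiple of the Fock
space of `H` on which `ℓ(W ξ)` acts as `ℓ(ξ) ⊗ 1`. Together this gives an isometry `S` with `(ℓ(ξ)*
⊗ 1) S = S ℓ(T ξ)*` (`exists_stinespring`).

The compression `φ(x) = S* (x ⊗ 1) S` is then completely positive, normal and unital, and it
satisfies `φ(ℓ(ξ) x) = ℓ(T ξ) φ(x)` and `φ(x ℓ(ξ)*) = φ(x) ℓ(T ξ)*` on all bounded operators. Hence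
it acts letterwise on Wick ordered words. Because `ℓ(ξ)* ℓ(η)` is a scalar, these words span a dense
subspace of the Toeplitz algebra; continuity of completely positive maps gives uniqueness.

For the Araki–Woods part, `I T I = T` is used only through its consequence that `T` preserves `K_ℝ`.
The ⋆-algebra generated by the fields is spanned by the Wick polynomials of words in `K_ℝ`
(`mem_span_wickPoly`), which `φ` permutes according to `T` and which produce the vectors `ξ₁ ⊗ ⋯ ⊗
ξₙ` from the vacuum. Invariance of the algebra and the identity `φ(x) Ω = Γ̃(T) x Ω` are thus clear
on a generating ⋆-algebra. They pass to the von Neumann algebra because normal functionals that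
agree on a unital ⋆-algebra agree on its bicommutant (`inner_amplify_eq_of_mem_bicommutant`).

The vacuum is separating because it is cyclic for operators in the commutant: the right fields of
`η` commute with the left fields of `ξ` when `⟪ξ, η⟫` is real, and the vectors `η` with this
property for all `ξ ∈ K_ℝ` are total, since `K_ℝ` is closed and `K_ℝ ∩ i K_ℝ = 0`. Closedness of
`K_ℝ` comes from that of the graph of `A^{-1/2}`, by the three lines theorem. -/

namespace ArakiWoods

/-! ### Summands of the Fock space and the relation `ℓ(ξ)* ℓ(η) = ⟪ξ, η⟫ 1`. -/

section FockBasics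

variable {H : Type u} [NormedAddCommGroup H] [InnerProductSpace ℂ H]

/-- The inclusion of `H^{⊗ n}` as a summand of the Fock space. -/
def fockIncl (n : ℕ) : TPow H n →ₗᵢ[ℂ] Fock H where
  toFun x := (lp.single 2 n x : lp (TPow H) 2)
  map_add' x y := map_add (lp.singleAddMonoidHom (E := TPow H) 2 n) x y
  map_smul' c x := lp.single_smul (E := TPow H) 2 n c x
  norm_map' x := lp.norm_single (E := TPow H) (by norm_num) n x

/-- A vector of the Fock space, as a square summable sequence. -/
def fockToLp (x : Fock H) : lp (TPow H) 2 := x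

/-- The projection of the Fock space onto its summand `H^{⊗ n}`. -/
def fockProj (n : ℕ) (x : Fock H) : TPow H n := fockToLp x n

theorem fockIncl_vacuumZero : fockIncl 0 (vacuumZero H) = vacuum H := rfl

theorem fock_ext {x y : Fock H} (h : ∀ n, fockProj n x = fockProj n y) : x = y :=
  lp.ext (E := TPow H) (funext h)

theorem fockProj_incl_self (n : ℕ) (x : TPow H n) : fockProj n (fockIncl n x) = x :=
  lp.single_apply_self (E := TPow H) 2 n x

theorem fockProj_incl_ne {m n : ℕ} (h : m ≠ n) (x : TPow H n) : fockProj m (fockIncl n x) = 0 :=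
  lp.single_apply_ne (E := TPow H) 2 n x h

theorem inner_fockIncl (n : ℕ) (x : TPow H n) (y : Fock H) :
    ⟪fockIncl n x, y⟫_ℂ = ⟪x, fockProj n y⟫_ℂ :=
  lp.inner_single_left (G := TPow H) n x y

theorem hasSum_fockIncl (x : Fock H) : HasSum (fun n => fockIncl n (fockProj n x)) x :=
  lp.hasSum_single (E := TPow H) (p := 2) (by norm_num) x

theorem fockProj_zero_creation (ξ : H) (x : Fock H) : fockProj 0 (creation ξ x) = 0 := rfl

theorem fockProj_succ_creation (ξ : H) (n : ℕ) (x : Fock H) :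
    fockProj (n + 1) (creation ξ x) = tensorLeft ξ n (fockProj n x) := rfl

theorem creation_fockIncl (ξ : H) (n : ℕ) (x : TPow H n) :
    creation ξ (fockIncl n x) = fockIncl (n + 1) (tensorLeft ξ n x) := by
  refine fock_ext fun m => ?_
  rcases m with _ | m
  · rw [fockProj_zero_creation, fockProj_incl_ne (by omega)]
  · rw [fockProj_succ_creation]
    by_cases h : m = n
    · subst h
      rw [fockProj_incl_self, fockProj_incl_self]
    · rw [fockProj_incl_ne h, fockProj_incl_ne (by omega), map_zero]

theorem inner_tensorLeft (ξ η : H) (n : ℕ) (x y : TPow H n) :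
    ⟪tensorLeft ξ n x, tensorLeft η n y⟫_ℂ = ⟪ξ, η⟫_ℂ * ⟪x, y⟫_ℂ :=
  (UniformSpace.Completion.inner_coe (ξ ⊗ₜ[ℂ] x : H ⊗[ℂ] TPow H n) (η ⊗ₜ[ℂ] y)).trans
    (TensorProduct.inner_tmul ..)

theorem inner_creation_creation (ξ η : H) (x y : Fock H) :
    ⟪creation ξ x, creation η y⟫_ℂ = ⟪ξ, η⟫_ℂ * ⟪x, y⟫_ℂ := by
  have h : HasSum (fun n => ⟪fockProj n x, fockProj n y⟫_ℂ) ⟪x, y⟫_ℂ :=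
    lp.hasSum_inner (G := TPow H) x y
  have h' : HasSum (fun n => ⟪fockProj n (creation ξ x), fockProj n (creation η y)⟫_ℂ)
      ⟪creation ξ x, creation η y⟫_ℂ :=
    lp.hasSum_inner (G := TPow H) (creation ξ x) (creation η y)
  refine h'.unique ((hasSum_nat_add_iff' 1).1 ?_)
  simpa [fockProj_succ_creation, inner_tensorLeft, fockProj_zero_creation] using
    h.mul_left ⟪ξ, η⟫_ℂ

theorem inner_vacuum_creation (ξ : H) (x : Fock H) : ⟪vacuum H, creation ξ x⟫_ℂ = 0 := by
  rw [← fockIncl_vacuumZero, inner_fockIncl, fockProj_zero_creation, inner_zero_right]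

theorem norm_vacuum : ‖vacuum H‖ = 1 := by
  rw [← fockIncl_vacuumZero, LinearIsometry.norm_map]
  exact (PiLp.norm_single 2 (fun _ : PUnit.{u + 1} => ℂ) PUnit.unit 1).trans norm_one

theorem tensorLeft_add (ξ η : H) (n : ℕ) (x : TPow H n) :
    tensorLeft (ξ + η) n x = tensorLeft ξ n x + tensorLeft η n x := by
  simp only [tensorLeft, map_add, ContinuousLinearMap.comp_add]
  rfl

theorem tensorLeft_smul (c : ℂ) (ξ : H) (n : ℕ) (x : TPow H n) :
    tensorLeft (c • ξ) n x = c • tensorLeft ξ n x := by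
  simp only [tensorLeft, map_smul, ContinuousLinearMap.comp_smul]
  rfl

theorem creation_add (ξ η : H) : creation (ξ + η) = creation ξ + creation η := by
  refine ContinuousLinearMap.ext fun x => fock_ext fun n => ?_
  rcases n with _ | n
  · exact (add_zero (0 : TPow H 0)).symm
  · exact tensorLeft_add ξ η n _

theorem creation_smul (c : ℂ) (ξ : H) : creation (c • ξ) = c • creation ξ := by
  refine ContinuousLinearMap.ext fun x => fock_ext fun n => ?_
  rcases n with _ | n
  · exact (smul_zero c : c • (0 : TPow H 0) = 0).symm
  · exact tensorLeft_smul c ξ n _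

theorem norm_creation_apply (ξ : H) (x : Fock H) : ‖creation ξ x‖ = ‖ξ‖ * ‖x‖ := by
  have h := inner_creation_creation ξ ξ x x
  simp only [inner_self_eq_norm_sq_to_K] at h
  have h' : ‖creation ξ x‖ ^ 2 = (‖ξ‖ * ‖x‖) ^ 2 := by
    rw [mul_pow]; exact_mod_cast h
  exact (sq_eq_sq₀ (norm_nonneg _) (by positivity)).1 h'

/-- The creation operators, as a bounded linear map into the operators on the Fock space. -/
def creationL : H →L[ℂ] Fock H →L[ℂ] Fock H :=
  LinearMap.mkContinuous
    { toFun := creation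
      map_add' := creation_add
      map_smul' := creation_smul } 1 fun ξ => by
    rw [one_mul]
    exact ContinuousLinearMap.opNorm_le_bound _ (norm_nonneg _) fun x =>
      (norm_creation_apply ξ x).le

@[simp] theorem creationL_apply (ξ : H) : creationL ξ = creation ξ := rfl

theorem scalars_eq_smul (x : Scalars.{u}) :
    ∃ c : ℂ, x = c • (EuclideanSpace.single PUnit.unit (1 : ℂ) : Scalars.{u}) :=
  ⟨x PUnit.unit, PiLp.ext fun i => by simp⟩

/-- A closed subspace that contains all `ξ ⊗ x` is the whole of `H^{⊗ (n+1)}`. -/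
theorem tpow_succ_induction {n : ℕ} {P : Submodule ℂ (TPow H (n + 1))}
    (hP : IsClosed (P : Set (TPow H (n + 1)))) (h : ∀ ξ x, tensorLeft ξ n x ∈ P)
    (x : TPow H (n + 1)) : x ∈ P := by
  refine UniformSpace.Completion.induction_on x hP fun y => ?_
  induction y using TensorProduct.induction_on with
  | zero => exact P.zero_mem
  | tmul ξ y => exact h ξ y
  | add y z hy hz =>
    rw [UniformSpace.Completion.coe_add]
    exact P.add_mem hy hz

theorem tpow_zero_eq_smul (x : TPow H 0) : ∃ c : ℂ, x = c • vacuumZero H := scalars_eq_smul x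

/-- A closed subspace of the Fock space which contains the vacuum and is stable under the creation
operators is the whole space. -/
theorem fock_induction {P : Submodule ℂ (Fock H)} (hP : IsClosed (P : Set (Fock H)))
    (h0 : vacuum H ∈ P) (h1 : ∀ ξ, ∀ x ∈ P, creation ξ x ∈ P) (x : Fock H) : x ∈ P := by
  have hincl : ∀ n (x : TPow H n), fockIncl n x ∈ P := by
    intro n
    induction n with
    | zero =>
      intro x
      obtain ⟨c, rfl⟩ : ∃ c : ℂ, x = c • vacuumZero H := tpow_zero_eq_smul x
      rw [map_smul, fockIncl_vacuumZero]
      exact P.smul_mem _ h0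
    | succ n ih =>
      intro x
      refine tpow_succ_induction (P := P.comap (fockIncl (H := H) (n + 1)).toLinearMap)
        (hP.preimage (fockIncl (H := H) (n + 1)).continuous) (fun ξ y => ?_) x
      change fockIncl (n + 1) (tensorLeft ξ n y) ∈ P
      rw [← creation_fockIncl]
      exact h1 ξ _ (ih y)
  exact hP.mem_of_tendsto (hasSum_fockIncl x)
    (Filter.Eventually.of_forall fun s => P.sum_mem fun n _ => hincl n _)

/-- Bounded operators on the Fock space that agree on the vacuum and propagate along the creation
operators are equal. -/
theorem fock_clm_ext {E : Type*} [NormedAddCommGroup E] [NormedSpace ℂ E] {f g : Fock H →L[ℂ] E}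
    (h0 : f (vacuum H) = g (vacuum H))
    (h1 : ∀ ξ x, f x = g x → f (creation ξ x) = g (creation ξ x)) : f = g := by
  ext x
  exact fock_induction (P := LinearMap.eqLocus f.toLinearMap g.toLinearMap)
    (isClosed_eq f.continuous g.continuous) h0 h1 x

section

variable {E : Type*} [NormedAddCommGroup E] [InnerProductSpace ℂ E] [CompleteSpace E]

/-- A family of operators `V ξ`, linear in `ξ`, is row isometric if
`(V ξ)* (V η) = ⟪ξ, η⟫ 1` for all `ξ`, `η`. -/
def IsRowIsometry (V : H →L[ℂ] E →L[ℂ] E) : Prop :=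
  ∀ ξ η x y, ⟪V ξ x, V η y⟫_ℂ = ⟪ξ, η⟫_ℂ * ⟪x, y⟫_ℂ

theorem IsRowIsometry.star_mul {V : H →L[ℂ] E →L[ℂ] E} (hV : IsRowIsometry V) (ξ η : H) :
    star (V ξ) * V η = ⟪ξ, η⟫_ℂ • 1 := by
  refine ContinuousLinearMap.ext fun x => ext_inner_left ℂ fun y => ?_
  rw [mul_apply_eq_comp, ContinuousLinearMap.star_eq_adjoint,
    ContinuousLinearMap.adjoint_inner_right, hV]
  simp [inner_smul_right]

theorem IsRowIsometry.star_apply_apply {V : H →L[ℂ] E →L[ℂ] E} (hV : IsRowIsometry V) (ξ η : H)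
    (x : E) : star (V ξ) (V η x) = ⟪ξ, η⟫_ℂ • x :=
  congrArg (fun f : E →L[ℂ] E => f x) (hV.star_mul ξ η)

end

theorem isRowIsometry_creationL : IsRowIsometry (creationL (H := H)) := inner_creation_creation

theorem star_creation_mul_creation (ξ η : H) :
    star (creation ξ) * creation η = ⟪ξ, η⟫_ℂ • (1 : Fock H →L[ℂ] Fock H) :=
  isRowIsometry_creationL.star_mul ξ η

theorem star_creation_creation (ξ η : H) (x : Fock H) :
    star (creation ξ) (creation η x) = ⟪ξ, η⟫_ℂ • x :=
  isRowIsometry_creationL.star_apply_apply ξ η x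

theorem inner_star_apply {E : Type*} [NormedAddCommGroup E] [InnerProductSpace ℂ E]
    [CompleteSpace E] (f : E →L[ℂ] E) (x y : E) : ⟪x, star f y⟫_ℂ = ⟪f x, y⟫_ℂ :=
  ContinuousLinearMap.adjoint_inner_right f x y

theorem star_creation_vacuum (ξ : H) : star (creation ξ) (vacuum H) = 0 :=
  ext_inner_left ℂ fun y => by
    rw [inner_star_apply, inner_zero_right, ← inner_conj_symm, inner_vacuum_creation, map_zero]

end FockBasics

/-! ### Isometries out of the Fock space defined by a row isometry and a unit vector. -/

section Lift

variable {H : Type u} [NormedAddCommGroup H] [InnerProductSpace ℂ H]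
variable {E : Type v} [NormedAddCommGroup E] [InnerProductSpace ℂ E] [CompleteSpace E]

/-- The extension of a linear isometry to the completion of its domain. -/
def isometryFromCompletion {X : Type*} [NormedAddCommGroup X] [InnerProductSpace ℂ X]
    (f : X →ₗᵢ[ℂ] E) : UniformSpace.Completion X →ₗᵢ[ℂ] E where
  toLinearMap := f.toContinuousLinearMap.fromCompletion.toLinearMap
  norm_map' x := by
    induction x using UniformSpace.Completion.induction_on with
    | hp => exact isClosed_eq (by fun_prop) (by fun_prop)
    | ih x => simp

theorem isometryFromCompletion_coe {X : Type*} [NormedAddCommGroup X] [InnerProductSpace ℂ X]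
    (f : X →ₗᵢ[ℂ] E) (x : X) : isometryFromCompletion f x = f x :=
  f.toContinuousLinearMap.fromCompletion_apply_coe x

/-- The isometry `ℂ → E` with `1 ↦ w`, for a unit vector `w`. -/
def scalarsIsometry (w : E) (hw : ‖w‖ = 1) : Scalars.{u} →ₗᵢ[ℂ] E where
  toFun x := x PUnit.unit • w
  map_add' x y := by simp [add_smul]
  map_smul' c x := by simp [mul_smul]
  norm_map' x := by
    change ‖x PUnit.unit • w‖ = ‖x‖
    rw [norm_smul, hw, mul_one, EuclideanSpace.norm_eq]
    simp

/-- The isometry `ξ ⊗ x ↦ V ξ (R x)` given by a row isometry `V` and an isometry `R`. -/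
def tensorIsometry {V : H →L[ℂ] E →L[ℂ] E} (hV : IsRowIsometry V) {F : Type*}
    [NormedAddCommGroup F] [InnerProductSpace ℂ F] (R : F →ₗᵢ[ℂ] E) : H ⊗[ℂ] F →ₗᵢ[ℂ] E :=
  LinearMap.isometryOfInner
    (TensorProduct.lift (LinearMap.mk₂ ℂ (fun ξ x => V ξ (R x)) (by simp) (by simp) (by simp)
      (by simp))) fun x y => by
    induction x using TensorProduct.induction_on with
    | zero => simp
    | add x x' hx hx' => simp only [map_add, inner_add_left, hx, hx']
    | tmul ξ x =>
      induction y using TensorProduct.induction_on with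
      | zero => simp
      | add y y' hy hy' => simp only [map_add, inner_add_right, hy, hy']
      | tmul η y => simp [hV ξ η (R x) (R y)]

/-- The isometries `H^{⊗ n} → E`, `ξ₁ ⊗ ⋯ ⊗ ξₙ ↦ V ξ₁ ⋯ V ξₙ w`, for a row isometry `V` and a unit
vector `w`. -/
def powerLift {V : H →L[ℂ] E →L[ℂ] E} (hV : IsRowIsometry V) (w : E) (hw : ‖w‖ = 1) :
    ∀ n, TPow H n →ₗᵢ[ℂ] E
  | 0 => scalarsIsometry w hw
  | n + 1 => isometryFromCompletion (tensorIsometry hV (powerLift hV w hw n))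

variable {V : H →L[ℂ] E →L[ℂ] E} (hV : IsRowIsometry V) {w : E} (hw : ‖w‖ = 1)

theorem powerLift_vacuumZero : powerLift hV w hw 0 (vacuumZero H) = w := by
  change (EuclideanSpace.single PUnit.unit (1 : ℂ) : Scalars.{u}) PUnit.unit • w = w
  simp

theorem powerLift_tensorLeft (n : ℕ) (ξ : H) (x : TPow H n) :
    powerLift hV w hw (n + 1) (tensorLeft ξ n x) = V ξ (powerLift hV w hw n x) :=
  isometryFromCompletion_coe (tensorIsometry hV (powerLift hV w hw n)) (ξ ⊗ₜ[ℂ] x)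

theorem powerLift_mem (P : Submodule ℂ E) (hP : IsClosed (P : Set E)) (h0 : w ∈ P)
    (h1 : ∀ ξ x, V ξ x ∈ P) (n : ℕ) (x : TPow H n) : powerLift hV w hw n x ∈ P := by
  rcases n with _ | n
  · obtain ⟨c, rfl⟩ := tpow_zero_eq_smul x
    rw [map_smul, powerLift_vacuumZero]
    exact P.smul_mem _ h0
  · refine tpow_succ_induction (P := P.comap (powerLift hV w hw (n + 1)).toLinearMap)
      (hP.preimage (powerLift hV w hw (n + 1)).continuous) (fun ξ x => ?_) x
    change powerLift hV w hw (n + 1) (tensorLeft ξ n x) ∈ P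
    rw [powerLift_tensorLeft]
    exact h1 _ _

/-- The row isometry relation strips one letter off both words at the cost of a scalar, until the
shorter word is exhausted. What is left is the inner product of `w` with a vector in the range of
some `V ξ`, which is the only case that has to be assumed. -/
theorem inner_powerLift_of_lt (hwV : ∀ ξ n x, ⟪w, V ξ (powerLift hV w hw n x)⟫_ℂ = 0) {m n : ℕ}
    (hmn : m < n) (x : TPow H m) (y : TPow H n) :
    ⟪powerLift hV w hw m x, powerLift hV w hw n y⟫_ℂ = 0 := by
  obtain ⟨n, rfl⟩ : ∃ k, n = k + 1 := ⟨n - 1, by omega⟩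
  induction m generalizing n with
  | zero =>
    obtain ⟨c, rfl⟩ := tpow_zero_eq_smul x
    rw [map_smul, powerLift_vacuumZero, inner_smul_left]
    refine mul_eq_zero_of_right _ ?_
    refine tpow_succ_induction
      (P := LinearMap.ker ((innerSL ℂ w).comp
        (powerLift hV w hw (n + 1)).toContinuousLinearMap).toLinearMap)
      (ContinuousLinearMap.isClosed_ker _) (fun ξ x => ?_) y
    change ⟪w, powerLift hV w hw (n + 1) (tensorLeft ξ n x)⟫_ℂ = 0
    rw [powerLift_tensorLeft, hwV]
  | succ m ih =>
    obtain ⟨n, rfl⟩ : ∃ k, n = k + 1 := ⟨n - 1, by omega⟩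
    have key : ∀ ξ x, ⟪powerLift hV w hw (m + 1) (tensorLeft ξ m x),
        powerLift hV w hw (n + 1 + 1) y⟫_ℂ = 0 := by
      intro ξ x
      refine tpow_succ_induction
        (P := LinearMap.ker ((innerSL ℂ (powerLift hV w hw (m + 1) (tensorLeft ξ m x))).comp
          (powerLift hV w hw (n + 1 + 1)).toContinuousLinearMap).toLinearMap)
        (ContinuousLinearMap.isClosed_ker _) (fun η y => ?_) y
      change ⟪powerLift hV w hw (m + 1) (tensorLeft ξ m x),
        powerLift hV w hw (n + 1 + 1) (tensorLeft η (n + 1) y)⟫_ℂ = 0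
      rw [powerLift_tensorLeft, powerLift_tensorLeft, hV, ih _ n (by omega), mul_zero]
    rw [← inner_conj_symm]
    refine (map_eq_zero _).2 (tpow_succ_induction
      (P := LinearMap.ker ((innerSL ℂ (powerLift hV w hw (n + 1 + 1) y)).comp
        (powerLift hV w hw (m + 1)).toContinuousLinearMap).toLinearMap)
      (ContinuousLinearMap.isClosed_ker _) (fun ξ x => ?_) x)
    change ⟪powerLift hV w hw (n + 1 + 1) y, powerLift hV w hw (m + 1) (tensorLeft ξ m x)⟫_ℂ = 0
    rw [← inner_conj_symm, key, map_zero]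

theorem orthogonalFamily_powerLift (hwV : ∀ ξ n x, ⟪w, V ξ (powerLift hV w hw n x)⟫_ℂ = 0) :
    OrthogonalFamily ℂ (TPow H) (powerLift hV w hw) := by
  intro m n hmn x y
  rcases lt_or_gt_of_ne hmn with h | h
  · exact inner_powerLift_of_lt hV hw hwV h x y
  · rw [← inner_conj_symm, inner_powerLift_of_lt hV hw hwV h y x, map_zero]

/-- If `V` is a row isometry and `w` is a unit vector such that the `V ξ₁ ⋯ V ξₙ w` of different
lengths are orthogonal, then `ξ₁ ⊗ ⋯ ⊗ ξₙ ↦ V ξ₁ ⋯ V ξₙ w` extends to an isometry of the Fock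
space. -/
theorem exists_fockLift (hwV : ∀ ξ n x, ⟪w, V ξ (powerLift hV w hw n x)⟫_ℂ = 0) :
    ∃ R : Fock H →ₗᵢ[ℂ] E, R (vacuum H) = w ∧ ∀ ξ x, R (creation ξ x) = V ξ (R x) := by
  let R : Fock H →ₗᵢ[ℂ] E := (orthogonalFamily_powerLift hV hw hwV).linearIsometry
  have hR : ∀ n (x : TPow H n), R (fockIncl n x) = powerLift hV w hw n x := fun n x =>
    (orthogonalFamily_powerLift hV hw hwV).linearIsometry_apply_single x
  refine ⟨R, ?_, fun ξ x => ?_⟩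
  · rw [← fockIncl_vacuumZero, hR, powerLift_vacuumZero]
  · have h1 := ((hasSum_fockIncl x).mapL (creation ξ)).mapL R.toContinuousLinearMap
    have h2 := ((hasSum_fockIncl x).mapL R.toContinuousLinearMap).mapL (V ξ)
    refine h1.unique (h2.congr_fun fun n => ?_)
    change R (creation ξ (fockIncl n _)) = V ξ (R (fockIncl n _))
    rw [creation_fockIncl, hR, hR, powerLift_tensorLeft]

end Lift

/-! ### Wandering vectors. -/

section Wandering

variable {H : Type u} [NormedAddCommGroup H] [InnerProductSpace ℂ H]
variable {E : Type v} [NormedAddCommGroup E] [InnerProductSpace ℂ E] [CompleteSpace E]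
variable {V : H →L[ℂ] E →L[ℂ] E}

/-- A wandering unit vector of a row isometry generates a copy of the Fock space. -/
theorem exists_fockLift_of_wandering (hV : IsRowIsometry V) {w : E} (hw : ‖w‖ = 1)
    (hwV : ∀ ξ, star (V ξ) w = 0) :
    ∃ R : Fock H →ₗᵢ[ℂ] E, R (vacuum H) = w ∧ ∀ ξ x, R (creation ξ x) = V ξ (R x) :=
  exists_fockLift hV hw fun ξ n x => by
    rw [← ContinuousLinearMap.adjoint_inner_left, ← ContinuousLinearMap.star_eq_adjoint, hwV,
      inner_zero_left]

/-- The lift of a wandering vector intertwines the adjoints, too. -/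
theorem fockLift_star (hV : IsRowIsometry V) {w : E} {R : Fock H →ₗᵢ[ℂ] E}
    (hwV : ∀ ξ, star (V ξ) w = 0) (hR0 : R (vacuum H) = w)
    (hR : ∀ ξ x, R (creation ξ x) = V ξ (R x)) (ξ : H) (x : Fock H) :
    R (star (creation ξ) x) = star (V ξ) (R x) := by
  have := fock_clm_ext (f := R.toContinuousLinearMap.comp (star (creation ξ)))
    (g := (star (V ξ)).comp R.toContinuousLinearMap)
    (by simp [star_creation_vacuum, hR0, hwV])
    (fun η x _ => by simp [star_creation_creation, hR, hV.star_apply_apply])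
  exact congrArg (fun f : Fock H →L[ℂ] E => f x) this

end Wandering

/-! ### Amplifications `x ⊗ 1`. -/

section Amplification

variable {E : Type u} [NormedAddCommGroup E] [InnerProductSpace ℂ E]

/-- The Hilbert space direct sum of copies of `E` indexed by `I`. -/
abbrev Amplified (I : Type v) (E : Type u) [NormedAddCommGroup E] : Type (max u v) :=
  lp (fun _ : I => E) 2

/-- The diagonal operator with all entries equal to `x`. -/
def diagonal (I : Type v) (x : E →L[ℂ] E) : Amplified I E →L[ℂ] Amplified I E :=
  lp.mapCLM 2 (fun _ : I => x) (norm_nonneg x) fun _ => le_rfl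

theorem diagonal_apply {I : Type v} (x : E →L[ℂ] E) (f : Amplified I E) (i : I) :
    diagonal I x f i = x (f i) := rfl

variable [CompleteSpace E]

/-- The amplification `x ↦ x ⊗ 1` of the operators on `E` to a direct sum of copies of `E`. -/
def amplify (I : Type v) (E : Type u) [NormedAddCommGroup E] [InnerProductSpace ℂ E]
    [CompleteSpace E] :
    (E →L[ℂ] E) →⋆ₐ[ℂ] (Amplified I E →L[ℂ] Amplified I E) where
  toFun := diagonal I
  map_one' := by ext f i; rfl
  map_mul' x y := by ext f i; rfl
  map_zero' := by ext f i; rfl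
  map_add' x y := by ext f i; rfl
  commutes' c := by
    ext f i
    simp [diagonal_apply, Algebra.algebraMap_eq_smul_one]
  map_star' x := by
    refine ContinuousLinearMap.ext fun f => ext_inner_left ℂ fun g => ?_
    rw [inner_star_apply, lp.inner_eq_tsum, lp.inner_eq_tsum]
    simp only [diagonal_apply, inner_star_apply]

theorem amplify_apply {I : Type v} (x : E →L[ℂ] E) (f : Amplified I E) (i : I) :
    amplify I E x f i = x (f i) := rfl

end Amplification

/-! ### The Wold decomposition. -/

section Wold

variable {H : Type u} [NormedAddCommGroup H] [InnerProductSpace ℂ H]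
variable {L : Type v} [NormedAddCommGroup L] [InnerProductSpace ℂ L]

/-- The row isometry `ξ ↦ ℓ(W ξ)` of an isometry `W`. -/
def isometryCreation (W : H →ₗᵢ[ℂ] L) : H →L[ℂ] Fock L →L[ℂ] Fock L :=
  creationL.comp W.toContinuousLinearMap

theorem isometryCreation_apply (W : H →ₗᵢ[ℂ] L) (ξ : H) :
    isometryCreation W ξ = creation (W ξ) := rfl

theorem isRowIsometry_isometryCreation (W : H →ₗᵢ[ℂ] L) : IsRowIsometry (isometryCreation W) := by
  intro ξ η x y
  rw [isometryCreation_apply, isometryCreation_apply, inner_creation_creation,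
    LinearIsometry.inner_map_map]

/-- Orthogonality of the generating vectors propagates to the ranges: letters on the right factor
are moved to the left one as adjoints, and the lifts intertwine the adjoints as well. -/
theorem orthogonalFamily_fockLift {E : Type*} [NormedAddCommGroup E] [InnerProductSpace ℂ E]
    [CompleteSpace E] {V : H →L[ℂ] E →L[ℂ] E} (hV : IsRowIsometry V) {I : Type*} {w : I → E}
    (hw : Pairwise fun i j => ⟪w i, w j⟫_ℂ = 0) (hwV : ∀ i ξ, star (V ξ) (w i) = 0)
    {R : I → Fock H →ₗᵢ[ℂ] E} (hR0 : ∀ i, R i (vacuum H) = w i)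
    (hR : ∀ i ξ x, R i (creation ξ x) = V ξ (R i x)) :
    OrthogonalFamily ℂ (fun _ : I => Fock H) R := by
  intro i j hij x y
  have h0 : ∀ x, ⟪R i x, w j⟫_ℂ = 0 := by
    intro x
    have := fock_clm_ext (f := (innerSL ℂ (w j)).comp (R i).toContinuousLinearMap) (g := 0)
      (by simp [hR0, hw hij.symm]) (fun ξ x _ => by
        simp [hR, ← ContinuousLinearMap.adjoint_inner_left,
          ← ContinuousLinearMap.star_eq_adjoint, hwV])
    have h : ⟪w j, R i x⟫_ℂ = 0 := congrArg (fun f : Fock H →L[ℂ] ℂ => f x) this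
    rw [← inner_conj_symm, h, map_zero]
  have key : ∀ x, ⟪R i x, R j y⟫_ℂ = 0 := by
    -- The induction on `y` replaces `x` by `ℓ(ξ)* x`, so the statement is needed for all `x`
    -- simultaneously; the infimum of the kernels records this as one closed subspace.
    suffices h : y ∈ ⨅ x, LinearMap.ker ((innerSL ℂ (R i x)).comp
        (R j).toContinuousLinearMap).toLinearMap from fun x => (Submodule.mem_iInf _).1 h x
    refine fock_induction ?_ ?_ ?_ y
    · rw [Submodule.coe_iInf]
      exact isClosed_iInter fun x => ContinuousLinearMap.isClosed_ker _
    · rw [Submodule.mem_iInf]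
      intro x
      simp [hR0, h0]
    · intro ξ z hz
      rw [Submodule.mem_iInf] at hz ⊢
      intro x
      have := hz (star (creation ξ) x)
      simp only [LinearMap.mem_ker, ContinuousLinearMap.coe_coe, ContinuousLinearMap.comp_apply,
        innerSL_apply_apply, LinearIsometry.coe_toContinuousLinearMap] at this ⊢
      rw [fockLift_star hV (hwV i) (hR0 i) (hR i), ContinuousLinearMap.star_eq_adjoint,
        ContinuousLinearMap.adjoint_inner_left] at this
      rw [hR, this]
  exact key x

/-- Wold decomposition of the row isometry `ξ ↦ ℓ(W ξ)`: the Fock space of `L` is a direct sum of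
copies of the Fock space of `H`. -/
theorem exists_wold [CompleteSpace H] (W : H →ₗᵢ[ℂ] L) :
    ∃ (I : Type v) (R : I → Fock H →ₗᵢ[ℂ] Fock L),
      IsHilbertSum ℂ (fun _ : I => Fock H) R ∧
      ∀ i ξ x, R i (star (creation ξ) x) = star (creation (W ξ)) (R i x) := by
  have hV := isRowIsometry_isometryCreation W
  -- `D` is the space of wandering vectors. A Hilbert basis of it indexes the copies of the Fock
  -- space of `H`.
  let D : Submodule ℂ (Fock L) := ⨅ ξ, LinearMap.ker (star (isometryCreation W ξ)).toLinearMap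
  have hDcl : IsClosed (D : Set (Fock L)) := by
    rw [Submodule.coe_iInf]
    exact isClosed_iInter fun x => ContinuousLinearMap.isClosed_ker _
  have hD : ∀ d, d ∈ D ↔ ∀ ξ, star (isometryCreation W ξ) d = 0 := fun d => by
    simp [D, Submodule.mem_iInf]
  have : CompleteSpace D := hDcl.completeSpace_coe
  obtain ⟨I, b, -⟩ := exists_hilbertBasis ℂ D
  have hwV : ∀ (i : I) ξ, star (isometryCreation W ξ) (b i : Fock L) = 0 := fun i =>
    (hD _).1 (b i).2
  have hnorm : ∀ i : I, ‖(b i : Fock L)‖ = 1 := fun i => b.orthonormal.1 i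
  choose R hR0 hR using fun i : I => exists_fockLift_of_wandering hV (hnorm i) (hwV i)
  have hRs := fun i : I => fockLift_star hV (hwV i) (hR0 i) (hR i)
  have hO : OrthogonalFamily ℂ (fun _ : I => Fock H) R :=
    orthogonalFamily_fockLift hV (fun i j hij => b.orthonormal.2 hij) hwV hR0 hR
  refine ⟨I, R, IsHilbertSum.mk hO (top_le_iff.2 ?_), hRs⟩
  rw [Submodule.topologicalClosure_eq_top_iff]
  set N := (⨆ i, LinearMap.range (R i).toLinearMap)ᗮ with hNdef
  have hN : ∀ y, y ∈ N ↔ ∀ i x, ⟪R i x, y⟫_ℂ = 0 := fun y => by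
    rw [hNdef, Submodule.mem_orthogonal]
    refine ⟨fun h i x => h _ (Submodule.mem_iSup_of_mem i ⟨x, rfl⟩), fun h u hu => ?_⟩
    induction hu using Submodule.iSup_induction' with
    | mem i x hx => obtain ⟨x, rfl⟩ := hx; exact h i x
    | zero => simp
    | add x y _ _ hx hy => rw [inner_add_left, hx, hy, add_zero]
  have hNstar : ∀ y ∈ N, ∀ ξ, star (creation (W ξ)) y ∈ N := fun y hy ξ => by
    rw [hN] at hy ⊢
    intro i x
    rw [inner_star_apply]
    exact hR i ξ x ▸ hy i (creation ξ x)
  have hND : ∀ y ∈ N, ∀ d ∈ D, ⟪y, d⟫_ℂ = 0 := fun y hy d hd => by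
    have : (Submodule.span ℂ (Set.range b)).topologicalClosure ≤
        LinearMap.ker ((innerSL ℂ y).comp D.subtypeL).toLinearMap := by
      refine Submodule.topologicalClosure_minimal _ (Submodule.span_le.2 ?_)
        (ContinuousLinearMap.isClosed_ker _)
      rintro _ ⟨i, rfl⟩
      have := (hN y).1 hy i (vacuum H)
      rw [hR0] at this
      change ⟪y, (b i : Fock L)⟫_ℂ = 0
      rw [← inner_conj_symm, this, map_zero]
    rw [b.dense_span] at this
    exact this (x := ⟨d, hd⟩) trivial
  have : CompleteSpace (LinearMap.range W.toLinearMap) :=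
    (W.isometry.isUniformInducing.isComplete_range).completeSpace_coe
  -- There is no residual part: the orthogonal complement of `N` contains the vacuum, which is
  -- wandering, and is stable under all creation operators of `L`, so it is the whole space.
  have key : ∀ x, x ∈ Nᗮ := by
    refine fock_induction (Submodule.isClosed_orthogonal _) ?_ ?_
    · rw [Submodule.mem_orthogonal]
      exact fun y hy => hND y hy _ ((hD _).2 fun ξ => star_creation_vacuum _)
    · intro k x hx
      rw [Submodule.mem_orthogonal] at hx ⊢
      intro y hy
      -- A letter splits into `W ξ`, whose adjoint creation operator leaves `N` invariant, and `k'`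
      -- orthogonal to the range of `W`, for which `ℓ(k') x` is wandering and hence orthogonal to
      -- `N`.
      obtain ⟨_, ⟨ξ, rfl⟩, k', hk', rfl⟩ :=
        (LinearMap.range W.toLinearMap).exists_add_mem_mem_orthogonal k
      have h1 := hx _ (hNstar y hy ξ)
      rw [ContinuousLinearMap.star_eq_adjoint, ContinuousLinearMap.adjoint_inner_left] at h1
      have h2 : ⟪y, creation k' x⟫_ℂ = 0 := by
        refine hND y hy _ ((hD _).2 fun η => ?_)
        have h : ⟪W η, k'⟫_ℂ = 0 := (Submodule.mem_orthogonal _ _).1 hk' _ ⟨η, rfl⟩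
        rw [isometryCreation_apply, star_creation_creation, h, zero_smul]
      rw [creation_add, add_apply, inner_add_right, h2, add_zero]
      exact h1
  rw [Submodule.eq_bot_iff]
  intro y hy
  exact inner_self_eq_zero.1 ((Submodule.mem_orthogonal _ _).1 (key y) y hy)

end Wold

/-! ### Dilation of a contraction and the intertwining isometry. -/

section Dilation

variable {H : Type u} [NormedAddCommGroup H] [InnerProductSpace ℂ H]
variable {K : Type v} [NormedAddCommGroup K] [InnerProductSpace ℂ K]

/-- The dilation of a contraction `T` with defect operator `D` to the isometry `ξ ↦ (T ξ, D ξ)`. -/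
def dilation (T : H →L[ℂ] K) (D : H →L[ℂ] H) (hD : ∀ x, ‖T x‖ ^ 2 + ‖D x‖ ^ 2 = ‖x‖ ^ 2) :
    H →ₗᵢ[ℂ] WithLp 2 (K × H) where
  toFun x := WithLp.toLp 2 (T x, D x)
  map_add' x y := by simp [← WithLp.toLp_add]
  map_smul' c x := by simp [← WithLp.toLp_smul]
  norm_map' x := by
    refine (sq_eq_sq₀ (norm_nonneg _) (norm_nonneg _)).1 ?_
    rw [← hD x]
    exact WithLp.prod_norm_sq_eq_of_L2 (α := K) (β := H) _

/-- The isometry `η ↦ (η, 0)`. -/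
def inclLeft (K : Type v) (H : Type u) [NormedAddCommGroup K] [InnerProductSpace ℂ K]
    [NormedAddCommGroup H] [InnerProductSpace ℂ H] : K →ₗᵢ[ℂ] WithLp 2 (K × H) where
  toFun x := WithLp.toLp 2 (x, 0)
  map_add' x y := by simp [← WithLp.toLp_add]
  map_smul' c x := by simp [← WithLp.toLp_smul]
  norm_map' x := by
    refine (sq_eq_sq₀ (norm_nonneg _) (norm_nonneg _)).1 ?_
    simp

theorem inner_dilation_inclLeft (T : H →L[ℂ] K) (D : H →L[ℂ] H)
    (hD : ∀ x, ‖T x‖ ^ 2 + ‖D x‖ ^ 2 = ‖x‖ ^ 2) (x : H) (y : K) :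
    ⟪dilation T D hD x, inclLeft K H y⟫_ℂ = ⟪T x, y⟫_ℂ :=
  (WithLp.prod_inner_apply (𝕜 := ℂ) (WithLp.toLp 2 (T x, D x)) (WithLp.toLp 2 (y, (0 : H)))).trans
    (by simp)

variable [CompleteSpace H] [CompleteSpace K]

/-- Any factorization `1 - T* T = D* D` will do, and positivity of `1 - T* T` provides one; `D` need
not be the positive square root. -/
theorem exists_defect (T : H →L[ℂ] K) (hT : ‖T‖ ≤ 1) :
    ∃ D : H →L[ℂ] H, ∀ x, ‖T x‖ ^ 2 + ‖D x‖ ^ 2 = ‖x‖ ^ 2 := by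
  have hpos : 0 ≤ 1 - (ContinuousLinearMap.adjoint T).comp T := by
    rw [ContinuousLinearMap.nonneg_iff_isPositive]
    refine ⟨?_, fun x => ?_⟩
    · intro x y
      simp [inner_sub_left, inner_sub_right, ContinuousLinearMap.adjoint_inner_left,
        ContinuousLinearMap.adjoint_inner_right]
    · have : ‖T x‖ ≤ ‖x‖ := (T.le_of_opNorm_le hT x).trans_eq (one_mul _)
      simp only [ContinuousLinearMap.reApplyInnerSelf_apply, sub_apply, one_apply_eq_self,
        ContinuousLinearMap.comp_apply, inner_sub_left, ContinuousLinearMap.adjoint_inner_left,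
        map_sub, inner_self_eq_norm_sq]
      nlinarith [norm_nonneg (T x), norm_nonneg x]
  obtain ⟨D, hD⟩ := CStarAlgebra.nonneg_iff_eq_star_mul_self.1 hpos
  refine ⟨D, fun x => ?_⟩
  have h := congrArg (fun f : H →L[ℂ] H => RCLike.re ⟪x, f x⟫_ℂ) hD
  simp only [sub_apply, one_apply_eq_self, mul_apply_eq_comp, inner_star_apply, inner_sub_right,
    ContinuousLinearMap.comp_apply, ContinuousLinearMap.adjoint_inner_right, map_sub,
    inner_self_eq_norm_sq] at h
  linarith

/-- For every contraction `T`, there is an isometry `S` of the Fock space of `K` into a multiple of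
the Fock space of `H` with `(ℓ(ξ)* ⊗ 1) S = S ℓ(T ξ)*`. -/
theorem exists_stinespring (T : H →L[ℂ] K) (hT : ‖T‖ ≤ 1) :
    ∃ (I : Type (max u v)) (S : Fock K →ₗᵢ[ℂ] Amplified I (Fock H)),
      ∀ ξ x, amplify I (Fock H) (star (creation ξ)) (S x) = S (star (creation (T ξ)) x) := by
  obtain ⟨D, hD⟩ := exists_defect T hT
  obtain ⟨I, R, hsum, hR⟩ := exists_wold (dilation T D hD)
  have hι := isRowIsometry_isometryCreation (inclLeft K H)
  obtain ⟨j, hj0, hj⟩ := exists_fockLift_of_wandering hι norm_vacuum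
    fun ξ => star_creation_vacuum _
  -- Both sides vanish on the vacuum, and on `ℓ(η) x` both equal `⟪T ξ, η⟫ j x`.
  have hjs : ∀ ξ x, star (creation (dilation T D hD ξ)) (j x) = j (star (creation (T ξ)) x) := by
    intro ξ x
    have := fock_clm_ext
      (f := (star (creation (dilation T D hD ξ))).comp j.toContinuousLinearMap)
      (g := j.toContinuousLinearMap.comp (star (creation (T ξ))))
      (by simp [hj0, star_creation_vacuum])
      (fun η x _ => by
        simp [hj, isometryCreation_apply, star_creation_creation, inner_dilation_inclLeft,
          -WithLp.prod_inner_apply])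
    exact congrArg (fun f : Fock K →L[ℂ] _ => f x) this
  let U := hsum.linearIsometryEquiv
  have hU : ∀ ξ f, U.symm (amplify I (Fock H) (star (creation ξ)) f) =
      star (creation (dilation T D hD ξ)) (U.symm f) := by
    intro ξ f
    refine (hsum.hasSum_linearIsometryEquiv_symm _).unique ?_
    refine ((hsum.hasSum_linearIsometryEquiv_symm f).mapL
      (star (creation (dilation T D hD ξ)))).congr_fun fun i => ?_
    exact hR i ξ (f i)
  refine ⟨I, U.toLinearIsometry.comp j, fun ξ x => ?_⟩
  apply U.symm.injective
  rw [hU]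
  simp [hjs]

end Dilation

/-! ### Negative parts of self-adjoint elements. -/

section NegPart

variable {B : Type*} [NonUnitalCStarAlgebra B] [PartialOrder B] [StarOrderedRing B]

theorem exists_star_mul_self_of_nonneg {a : B} (ha : 0 ≤ a) : ∃ b, a = star b * b :=
  CStarAlgebra.nonneg_iff_eq_star_mul_self.1 ha

/-- Here `c` is the negative part, and `a c = -c²` because the positive and negative parts
annihilate each other. -/
theorem exists_negPart {a : B} (ha : IsSelfAdjoint a) :
    ∃ c d : B, star c = c ∧ c = star d * d ∧ a * c = -(c * c) ∧ (c = 0 → 0 ≤ a) := by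
  obtain ⟨d, hd⟩ := exists_star_mul_self_of_nonneg (CFC.negPart_nonneg a)
  refine ⟨a⁻, d, (CFC.negPart_nonneg a).isSelfAdjoint, hd, ?_, (CFC.negPart_eq_zero_iff a ha).1⟩
  have h := congrArg (· * a⁻) (CFC.posPart_sub_negPart a ha)
  simpa only [sub_mul, CFC.posPart_mul_negPart, zero_sub] using h.symm

end NegPart

/-! ### Positivity of operator matrices through quadratic forms. -/

section MatrixPositivity

variable {A : Type*} [CStarAlgebra A]
variable {E : Type*} [NormedAddCommGroup E] [InnerProductSpace ℂ E] [CompleteSpace E]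
variable {n : Type*} [Fintype n]

/-- The action of matrices over `A` on tuples of vectors, for a representation `π` of `A`. -/
def matVec (π : A →⋆ₐ[ℂ] (E →L[ℂ] E)) (M : CStarMatrix n n A) (v : n → E) (a : n) : E :=
  ∑ b, π (M a b) (v b)

theorem matVec_mul (π : A →⋆ₐ[ℂ] (E →L[ℂ] E)) (M N : CStarMatrix n n A) (v : n → E) :
    matVec π (M * N) v = matVec π M (matVec π N v) := by
  funext a
  simp only [matVec, CStarMatrix.mul_apply, map_sum, map_mul, sum_apply, mul_apply_eq_comp]
  exact Finset.sum_comm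

theorem sum_inner_matVec_star (π : A →⋆ₐ[ℂ] (E →L[ℂ] E)) (M : CStarMatrix n n A) (u v : n → E) :
    ∑ a, ⟪u a, matVec π (star M) v a⟫_ℂ = ∑ a, ⟪matVec π M u a, v a⟫_ℂ := by
  simp only [matVec, CStarMatrix.star_apply, map_star, inner_sum, sum_inner, inner_star_apply]
  exact Finset.sum_comm

theorem matVec_neg (π : A →⋆ₐ[ℂ] (E →L[ℂ] E)) (M : CStarMatrix n n A) (v : n → E) :
    matVec π (-M) v = -matVec π M v := by
  funext a
  simp [matVec]

theorem sum_inner_matVec_star_mul_self (π : A →⋆ₐ[ℂ] (E →L[ℂ] E)) (M : CStarMatrix n n A)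
    (v : n → E) :
    ∑ a, ⟪v a, matVec π (star M * M) v a⟫_ℂ = ((∑ a, ‖matVec π M v a‖ ^ 2 : ℝ) : ℂ) := by
  rw [matVec_mul, sum_inner_matVec_star]
  simp [inner_self_eq_norm_sq_to_K]

theorem re_sum_inner_matVec_nonneg [PartialOrder A] [StarOrderedRing A] (π : A →⋆ₐ[ℂ] (E →L[ℂ] E))
    {M : CStarMatrix n n A} (hM : 0 ≤ M) (v : n → E) : 0 ≤ (∑ a, ⟪v a, matVec π M v a⟫_ℂ).re := by
  obtain ⟨N, rfl⟩ := exists_star_mul_self_of_nonneg hM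
  rw [sum_inner_matVec_star_mul_self, Complex.ofReal_re]
  positivity

theorem eq_zero_of_matVec_eq_zero [DecidableEq n] {π : A →⋆ₐ[ℂ] (E →L[ℂ] E)}
    (hπ : Function.Injective π) {M : CStarMatrix n n A} (hM : ∀ v a, matVec π M v a = 0) :
    M = 0 := by
  refine CStarMatrix.ext fun a b => hπ ?_
  rw [CStarMatrix.zero_apply, map_zero]
  ext x
  have := hM (Pi.single b x) a
  rw [matVec, Finset.sum_eq_single b (fun c _ hc => by simp [Pi.single_eq_of_ne hc]) (by simp)]
    at this
  simpa using this

/-- A self-adjoint matrix over `A` is positive if it is positive in a faithful representation. -/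
theorem cstarMatrix_nonneg [PartialOrder A] [StarOrderedRing A] [DecidableEq n]
    {π : A →⋆ₐ[ℂ] (E →L[ℂ] E)} (hπ : Function.Injective π)
    {M : CStarMatrix n n A} (hM : IsSelfAdjoint M)
    (h : ∀ v, 0 ≤ (∑ a, ⟪v a, matVec π M v a⟫_ℂ).re) : 0 ≤ M := by
  obtain ⟨C, N, hCsa, hN, hMC, hC⟩ := exists_negPart hM
  -- Testing the form of `M` on `C v`, with `C = N* N` the negative part, gives `-‖N C v‖² ≥ 0`.
  have hNC : N * C = 0 := by
    refine eq_zero_of_matVec_eq_zero hπ fun v a => ?_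
    have h1 := h (matVec π C v)
    rw [← matVec_mul, hMC, matVec_neg] at h1
    have h2 : C * C = star N * (N * C) := by rw [← mul_assoc, ← hN]
    simp only [Pi.neg_apply, inner_neg_right, Finset.sum_neg_distrib, Complex.neg_re] at h1
    rw [h2, matVec_mul, sum_inner_matVec_star, ← matVec_mul] at h1
    have h3 : (∑ a, ⟪matVec π (N * C) v a, matVec π (N * C) v a⟫_ℂ).re =
        ∑ a, ‖matVec π (N * C) v a‖ ^ 2 := by
      simp only [inner_self_eq_norm_sq_to_K, Complex.re_sum]
      norm_cast
    rw [h3] at h1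
    have h4 : ∑ a, ‖matVec π (N * C) v a‖ ^ 2 = 0 :=
      le_antisymm (by linarith) (by positivity)
    have := (Finset.sum_eq_zero_iff_of_nonneg fun a _ => by positivity).1 h4 a (Finset.mem_univ a)
    simpa using this
  have hCC : star C * C = 0 := by
    rw [hCsa]
    nth_rw 1 [hN]
    rw [mul_assoc, hNC, mul_zero]
  exact hC ((CStarRing.star_mul_self_eq_zero_iff C).1 hCC)

end MatrixPositivity

/-! ### Compressions `S* (x ⊗ 1) S` and their complete positivity. -/

section Stinespring

variable {E : Type u} [NormedAddCommGroup E] [InnerProductSpace ℂ E] [CompleteSpace E]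
variable {F : Type v} [NormedAddCommGroup F] [InnerProductSpace ℂ F] [CompleteSpace F]
variable {I : Type w}

/-- The map `x ↦ S* (x ⊗ 1) S`. -/
def compression (S : F →L[ℂ] Amplified I E) : (E →L[ℂ] E) →ₗ[ℂ] (F →L[ℂ] F) where
  toFun x := (ContinuousLinearMap.adjoint S).comp ((amplify I E x).comp S)
  map_add' x y := by simp [ContinuousLinearMap.comp_add, ContinuousLinearMap.add_comp]
  map_smul' c x := by simp [ContinuousLinearMap.smul_comp]

theorem inner_compression (S : F →L[ℂ] Amplified I E) (x : E →L[ℂ] E) (y z : F) :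
    ⟪y, compression S x z⟫_ℂ = ⟪S y, amplify I E x (S z)⟫_ℂ :=
  ContinuousLinearMap.adjoint_inner_right S _ _

theorem compression_star (S : F →L[ℂ] Amplified I E) (x : E →L[ℂ] E) :
    compression S (star x) = star (compression S x) := by
  refine ContinuousLinearMap.ext fun z => ext_inner_left ℂ fun y => ?_
  rw [inner_compression, inner_star_apply, map_star, inner_star_apply,
    ← inner_conj_symm (amplify I E x _),
    ← inner_compression, inner_conj_symm]

theorem continuous_compression (S : F →L[ℂ] Amplified I E) : Continuous (compression S) := by
  have h : Continuous (amplify I E) := map_continuous (amplify I E)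
  exact continuous_const.clm_comp (h.clm_comp continuous_const)

/-- The compression maps positive matrices to matrices with positive quadratic form. -/
theorem re_sum_inner_compression_nonneg {A : Type*} [CStarAlgebra A] [PartialOrder A]
    [StarOrderedRing A] (π : A →⋆ₐ[ℂ] (E →L[ℂ] E)) (S : F →L[ℂ] Amplified I E) {n : Type*}
    [Fintype n] {M : CStarMatrix n n A} (hM : 0 ≤ M) (v : n → F) :
    0 ≤ (∑ a, ⟪v a, ∑ b, compression S (π (M a b)) (v b)⟫_ℂ).re := by
  have h := re_sum_inner_matVec_nonneg ((amplify I E).comp π) hM fun a => S (v a)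
  simpa only [matVec, inner_sum, inner_compression, StarAlgHom.comp_apply] using h

/-- A compression that maps a C⋆-algebra of operators into another one is completely positive. -/
def compressionCP (S : F →L[ℂ] Amplified I E) (A : StarSubalgebra ℂ (E →L[ℂ] E))
    [IsClosed (A : Set (E →L[ℂ] E))] (B : StarSubalgebra ℂ (F →L[ℂ] F))
    [IsClosed (B : Set (F →L[ℂ] F))] (h : ∀ x ∈ A, compression S x ∈ B) : CPMap A B :=
  letI := CStarAlgebra.spectralOrder A
  letI := CStarAlgebra.spectralOrder B
  haveI := CStarAlgebra.spectralOrderedRing A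
  haveI := CStarAlgebra.spectralOrderedRing B
  { toFun := fun x => ⟨compression S x, h x x.2⟩
    map_add' := fun x y => Subtype.ext (map_add (compression S) (x : E →L[ℂ] E) y)
    map_smul' := fun c x => Subtype.ext (map_smul (compression S) c (x : E →L[ℂ] E))
    map_cstarMatrix_nonneg' := fun k M hM => by
      -- Positivity is required in the matrices over `B` itself. The inclusion of `B` into the
      -- operators on `F` is faithful, so the quadratic form on tuples of vectors decides it.
      refine cstarMatrix_nonneg (π := B.subtype) Subtype.val_injective ?_ fun v =>
        re_sum_inner_compression_nonneg A.subtype S hM v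
      refine CStarMatrix.ext fun a b => Subtype.ext ?_
      have hab : star (M b a) = M a b := congrFun (congrFun hM.isSelfAdjoint a) b
      change star (compression S (M b a)) = compression S (M a b)
      rw [← compression_star, ← hab]
      rfl }

theorem compressionCP_apply (S : F →L[ℂ] Amplified I E) (A : StarSubalgebra ℂ (E →L[ℂ] E))
    [IsClosed (A : Set (E →L[ℂ] E))] (B : StarSubalgebra ℂ (F →L[ℂ] F))
    [IsClosed (B : Set (F →L[ℂ] F))] (h : ∀ x ∈ A, compression S x ∈ B) (x : A) :
    (compressionCP S A B h x : F →L[ℂ] F) = compression S x := rfl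

/-- Positive linear maps between C⋆-algebras are automatically bounded, so a completely positive map
is determined by its values on a total set. -/
theorem CPMap.continuous {A : Type u} {B : Type v} [CStarAlgebra A] [CStarAlgebra B]
    (G : CPMap A B) : Continuous G :=
  letI := CStarAlgebra.spectralOrder A
  letI := CStarAlgebra.spectralOrder B
  haveI := CStarAlgebra.spectralOrderedRing A
  haveI := CStarAlgebra.spectralOrderedRing B
  map_continuous G

/-- Functionals `x ↦ ∑ᵢ ⟪ξᵢ, x ηᵢ⟫` over an arbitrary index set are `σ`-weakly continuous. -/
theorem continuous_sigmaWeak_amplify (ξ η : Amplified I E) :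
    @Continuous _ _ (sigmaWeak E) _ fun x : E →L[ℂ] E => ⟪ξ, amplify I E x η⟫_ℂ := by
  -- The topology is defined by sequences indexed by `ℕ`. A square summable family has countable
  -- support `s`, so both families can be restricted to `s` and carried to `ℕ` with zeros elsewhere;
  -- outside `s` the terms vanish because `ξ` does.
  have hc : (Function.support fun i => ‖ξ i‖ ^ 2).Countable := by
    have := (lp.memℓp ξ).summable (by norm_num)
    simp only [ENNReal.toReal_ofNat, Real.rpow_ofNat] at this
    exact this.countable_support
  set s := Function.support fun i => ‖ξ i‖ ^ 2
  obtain ⟨e, he⟩ := hc.to_subtype.exists_injective_nat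
  have hmem : ∀ f : Amplified I E, Memℓp (Function.extend e (fun i : s => f i) 0) 2 := by
    intro f
    have h1 := (lp.memℓp f).summable (by norm_num)
    refine memℓp_gen ?_
    simp only [ENNReal.toReal_ofNat, Real.rpow_ofNat] at h1 ⊢
    have h2 := h1.subtype s
    refine (he.summable_iff fun n hn => ?_).1 (h2.congr fun i => ?_)
    · rw [Function.extend_apply' _ _ _ hn]; simp
    · simp [he.extend_apply]
  have heq : (fun x : E →L[ℂ] E => ⟪ξ, amplify I E x η⟫_ℂ) = fun x =>
      ∑' k, ⟪(⟨_, hmem ξ⟩ : lp (fun _ : ℕ => E) 2) k,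
        x ((⟨_, hmem η⟩ : lp (fun _ : ℕ => E) 2) k)⟫_ℂ := by
    funext x
    rw [lp.inner_eq_tsum]
    have h1 : ∑' i, ⟪ξ i, amplify I E x η i⟫_ℂ = ∑' i : s, ⟪ξ i, x (η i)⟫_ℂ := by
      refine (tsum_subtype_eq_of_support_subset fun i hi => ?_).symm
      simp only [s, Function.mem_support] at hi ⊢
      intro h
      apply hi
      have : ξ i = 0 := by simpa using h
      simp [this]
    rw [h1]
    refine (Eq.trans ?_ (he.tsum_eq (f := fun k => ⟪Function.extend e (fun i : s => ξ i) 0 k,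
      x (Function.extend e (fun i : s => η i) 0 k)⟫_ℂ) ?_))
    · simp [he.extend_apply]
    · intro k hk
      by_contra hn
      apply hk
      simp [Function.extend_apply' _ _ _ hn]
  rw [heq]
  exact continuous_iff_le_induced.2 (iInf_le_of_le _ (iInf_le _ _))

end Stinespring

/-! ### Normality of compressions. -/

section Normality

variable {E : Type u} [NormedAddCommGroup E] {I : Type w} {J : Type*}

theorem summable_norm_sq (f : Amplified I E) : Summable fun i => ‖f i‖ ^ 2 := by
  have := (lp.memℓp f).summable (by norm_num)
  simpa only [ENNReal.toReal_ofNat, Real.rpow_ofNat] using this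

theorem norm_sq_eq_tsum (f : Amplified I E) : ‖f‖ ^ 2 = ∑' i, ‖f i‖ ^ 2 := by
  have := lp.norm_rpow_eq_tsum (p := 2) (by norm_num) f
  simpa only [ENNReal.toReal_ofNat, Real.rpow_ofNat] using this

/-- A direct sum of direct sums of copies of `E`, as a direct sum over the product. -/
def flatten (f : Amplified J (Amplified I E)) : Amplified (J × I) E :=
  ⟨fun p => f p.1 p.2, memℓp_gen (by
    simp only [ENNReal.toReal_ofNat, Real.rpow_ofNat]
    refine (summable_prod_of_nonneg fun p => by positivity).2 ⟨fun j => summable_norm_sq (f j), ?_⟩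
    simpa only [← norm_sq_eq_tsum] using summable_norm_sq f)⟩

variable [InnerProductSpace ℂ E]

theorem inner_flatten (f g : Amplified J (Amplified I E)) :
    ⟪flatten f, flatten g⟫_ℂ = ⟪f, g⟫_ℂ := by
  rw [lp.inner_eq_tsum, (lp.summable_inner (𝕜 := ℂ) (flatten f) (flatten g)).tsum_prod,
    lp.inner_eq_tsum]
  rfl

variable [CompleteSpace E]

theorem flatten_amplify (x : E →L[ℂ] E) (f : Amplified J (Amplified I E)) :
    flatten (amplify J (Amplified I E) (amplify I E x) f) = amplify (J × I) E x (flatten f) := rfl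

variable {F : Type v} [NormedAddCommGroup F] [InnerProductSpace ℂ F] [CompleteSpace F]

/-- Compressions are continuous for the `σ`-weak topologies. -/
theorem continuous_sigmaWeak_compression (S : F →L[ℂ] Amplified I E) :
    @Continuous _ _ (sigmaWeak E) (sigmaWeak F) (compression S) := by
  refine continuous_iInf_rng.2 fun ξ => continuous_iInf_rng.2 fun η => continuous_induced_rng.2 ?_
  let S' : Amplified ℕ F →L[ℂ] Amplified ℕ (Amplified I E) :=
    lp.mapCLM 2 (fun _ => S) (norm_nonneg S) fun _ => le_rfl
  -- A σ-weak functional composed with the compression is again of the form `x ↦ ⟪ξ', (x ⊗ 1) η'⟫`,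
  -- now over the index set `ℕ × I`.
  have h : (fun y : F →L[ℂ] F => ∑' n, ⟪ξ n, y (η n)⟫_ℂ) ∘ compression S =
      fun x => ⟪flatten (S' ξ), amplify (ℕ × I) E x (flatten (S' η))⟫_ℂ := by
    funext x
    rw [← flatten_amplify, inner_flatten, lp.inner_eq_tsum]
    exact tsum_congr fun n => inner_compression S x (ξ n) (η n)
  rw [h]
  exact continuous_sigmaWeak_amplify _ _

end Normality

/-! ### Passing from a ⋆-algebra to its bicommutant. -/

section Bicommutant

variable {E : Type u} [NormedAddCommGroup E] [InnerProductSpace ℂ E] [CompleteSpace E]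

/-- The amplification maps the bicommutant into the bicommutant. -/
theorem amplify_mem_bicommutant {I : Type v} {s : Set (E →L[ℂ] E)} {x : E →L[ℂ] E}
    (hx : x ∈ s.centralizer.centralizer) :
    amplify I E x ∈ (amplify I E '' s).centralizer.centralizer := by
  classical
  intro Q hQ
  have hsingle : ∀ (y : E →L[ℂ] E) (i : I) (e : E),
      amplify I E y (lp.single 2 i e) = lp.single 2 i (y e) := by
    intro y i e
    ext j
    rw [amplify_apply, lp.single_apply, lp.single_apply]
    by_cases h : j = i
    · subst h; simp
    · simp [h]
  refine lp.ext_continuousLinearMap (by norm_num) fun i => ?_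
  ext e j
  -- An operator commutes with `a ⊗ 1` exactly when each of its matrix entries commutes with `a`;
  -- `q` is the entry at `(j, i)`.
  let q : E →L[ℂ] E := (lp.evalCLM ℂ (fun _ : I => E) 2 j).comp
    (Q.comp (lp.singleContinuousLinearMap ℂ (fun _ : I => E) 2 i))
  have hq : q ∈ s.centralizer := by
    intro a ha
    have h := hQ _ ⟨a, ha, rfl⟩
    ext e
    have h' := congrArg (fun f : Amplified I E →L[ℂ] Amplified I E => f (lp.single 2 i e) j) h
    simp only [mul_apply_eq_comp, hsingle] at h'
    exact h'
  have h := congrArg (fun f : E →L[ℂ] E => f e) (hx q hq)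
  change Q (amplify I E x (lp.single 2 i e)) j = x (Q (lp.single 2 i e) j)
  rw [hsingle]
  exact h

/-- An operator in the bicommutant of a unital ⋆-algebra maps every vector into the closure of its
orbit under the algebra. -/
theorem apply_mem_closure_of_mem_bicommutant (A : StarSubalgebra ℂ (E →L[ℂ] E)) {x : E →L[ℂ] E}
    (hx : x ∈ (A : Set (E →L[ℂ] E)).centralizer.centralizer) (v : E) :
    x v ∈ closure ((fun a : E →L[ℂ] E => a v) '' (A : Set (E →L[ℂ] E))) := by
  let N₀ : Submodule ℂ E := A.toSubalgebra.toSubmodule.map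
    (ContinuousLinearMap.apply ℂ E v).toLinearMap
  let N := N₀.topologicalClosure
  have hN : (N : Set E) = closure ((fun a : E →L[ℂ] E => a v) '' (A : Set (E →L[ℂ] E))) := rfl
  have : CompleteSpace N := N₀.isClosed_topologicalClosure.completeSpace_coe
  have hinv : ∀ a ∈ A, ∀ y ∈ N, a y ∈ N := by
    intro a ha y hy
    refine map_mem_closure a.continuous hy ?_
    rintro _ ⟨b, hb, rfl⟩
    exact ⟨a * b, A.mul_mem ha hb, rfl⟩
  -- `N` is invariant under `A` and its adjoints, hence reducing, so its projection lies in the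
  -- commutant.
  have hP : N.starProjection ∈ (A : Set (E →L[ℂ] E)).centralizer := by
    intro a ha
    ext u
    refine (Submodule.eq_starProjection_of_mem_orthogonal
      (hinv a ha _ (N.starProjection_apply_mem u)) ?_).symm
    change a u - a (N.starProjection u) ∈ Nᗮ
    rw [← map_sub, Submodule.mem_orthogonal]
    intro y hy
    rw [← ContinuousLinearMap.adjoint_inner_left]
    exact (Submodule.mem_orthogonal _ _).1 (N.sub_starProjection_mem_orthogonal u) _
      (hinv _ (star_mem ha) y hy)
  have hv : v ∈ N := subset_closure ⟨1, one_mem A, rfl⟩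
  have h := congrArg (fun f : E →L[ℂ] E => f v) (hx _ hP)
  simp only [mul_apply_eq_comp, Submodule.starProjection_eq_self_iff.2 hv] at h
  rw [← hN]
  exact Submodule.starProjection_eq_self_iff.1 h

/-- Two normal functionals that agree on a unital ⋆-algebra agree on its bicommutant. -/
theorem inner_amplify_eq_of_mem_bicommutant (A : StarSubalgebra ℂ (E →L[ℂ] E)) {x : E →L[ℂ] E}
    (hx : x ∈ (A : Set (E →L[ℂ] E)).centralizer.centralizer) {I : Type v}
    {ξ η ξ' η' : Amplified I E}
    (h : ∀ a ∈ A, ⟪ξ, amplify I E a η⟫_ℂ = ⟪ξ', amplify I E a η'⟫_ℂ) :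
    ⟪ξ, amplify I E x η⟫_ℂ = ⟪ξ', amplify I E x η'⟫_ℂ := by
  let ρ := (amplify Bool (Amplified I E)).comp (amplify I E)
  let B := A.map ρ
  -- The difference of the two functionals is a single vector functional on the double of the space,
  -- so the orbit closure theorem applies to the one vector `θ`.
  let ζ : Amplified Bool (Amplified I E) := ⟨fun b => cond b ξ (-ξ'), Memℓp.all _⟩
  let θ : Amplified Bool (Amplified I E) := ⟨fun b => cond b η η', Memℓp.all _⟩
  have key : ∀ y, ⟪ζ, ρ y θ⟫_ℂ = ⟪ξ, amplify I E y η⟫_ℂ - ⟪ξ', amplify I E y η'⟫_ℂ := by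
    intro y
    rw [lp.inner_eq_tsum, tsum_bool, add_comm, sub_eq_add_neg, ← inner_neg_left]
    rfl
  have hρ : ρ x ∈ (B : Set _).centralizer.centralizer := by
    have := amplify_mem_bicommutant (I := Bool) (amplify_mem_bicommutant (I := I) hx)
    rw [← Set.image_comp] at this
    exact this
  have hcl : IsClosed {y : Amplified Bool (Amplified I E) | ⟪ζ, y⟫_ℂ = 0} :=
    isClosed_eq (by fun_prop) continuous_const
  have hmem := closure_minimal (t := {y : Amplified Bool (Amplified I E) | ⟪ζ, y⟫_ℂ = 0}) ?_ hcl
    (apply_mem_closure_of_mem_bicommutant B hρ θ)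
  · rw [Set.mem_ofPred_eq, key, sub_eq_zero] at hmem
    exact hmem
  · rintro _ ⟨_, ⟨a, ha, rfl⟩, rfl⟩
    change ⟪ζ, ρ a θ⟫_ℂ = 0
    rw [key, h a ha, sub_self]

/-- The commutant used to generate a von Neumann algebra is that of `s ∪ s*`, which is contained in
the generated ⋆-algebra. -/
theorem mem_bicommutant_adjoin {s : Set (E →L[ℂ] E)} {x : E →L[ℂ] E}
    (hx : x ∈ (vonNeumannGenerated s).toStarSubalgebra) :
    x ∈ (StarAlgebra.adjoin ℂ s : Set (E →L[ℂ] E)).centralizer.centralizer := by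
  have h : x ∈ (s ∪ star s).centralizer.centralizer := by
    rw [← StarSubalgebra.coe_centralizer_centralizer ℂ s]
    exact hx
  refine Set.centralizer_subset (Set.centralizer_subset ?_) h
  refine Set.union_subset (StarAlgebra.subset_adjoin ℂ s) fun y hy => ?_
  exact star_star y ▸ star_mem (StarAlgebra.subset_adjoin ℂ s hy)

variable {I : Type v}

/-- A compression that maps a generating ⋆-algebra into a von Neumann algebra maps the von Neumann
algebra generated into it. -/
theorem compression_mem_of_forall_adjoin {F : Type w} [NormedAddCommGroup F]
    [InnerProductSpace ℂ F] [CompleteSpace F] (S : F →L[ℂ] Amplified I E) {s : Set (E →L[ℂ] E)}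
    {t : Set (F →L[ℂ] F)}
    (h : ∀ a ∈ StarAlgebra.adjoin ℂ s, compression S a ∈ (vonNeumannGenerated t).toStarSubalgebra)
    {x : E →L[ℂ] E} (hx : x ∈ (vonNeumannGenerated s).toStarSubalgebra) :
    compression S x ∈ (vonNeumannGenerated t).toStarSubalgebra := by
  change compression S x ∈ (StarSubalgebra.centralizer ℂ (StarSubalgebra.centralizer ℂ t : Set _))
  -- For `y` in the commutant, the matrix coefficients of `y φ(x)` and of `φ(x) y` are both normal
  -- functionals of `x`, so it is enough to compare them on the generating ⋆-algebra.
  have key : ∀ y ∈ StarSubalgebra.centralizer ℂ t, y * compression S x = compression S x * y := by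
    intro y hy
    refine ContinuousLinearMap.ext fun η => ext_inner_left ℂ fun ξ => ?_
    have hform : ∀ a, ⟪ξ, (y * compression S a) η⟫_ℂ = ⟪S (star y ξ), amplify I E a (S η)⟫_ℂ ∧
        ⟪ξ, (compression S a * y) η⟫_ℂ = ⟪S ξ, amplify I E a (S (y η))⟫_ℂ := by
      intro a
      rw [← inner_compression, ← inner_compression, mul_apply_eq_comp, mul_apply_eq_comp,
        ContinuousLinearMap.star_eq_adjoint, ContinuousLinearMap.adjoint_inner_left]
      exact ⟨rfl, rfl⟩
    rw [(hform x).1, (hform x).2]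
    refine inner_amplify_eq_of_mem_bicommutant _ (mem_bicommutant_adjoin hx) fun a ha => ?_
    rw [← (hform a).1, ← (hform a).2]
    have := h a ha
    change compression S a ∈
      (StarSubalgebra.centralizer ℂ (StarSubalgebra.centralizer ℂ t : Set _)) at this
    rw [StarSubalgebra.mem_centralizer_iff] at this
    rw [(this y hy).1]
  rw [StarSubalgebra.mem_centralizer_iff]
  exact fun y hy => ⟨key y hy, key _ (star_mem hy)⟩

end Bicommutant

/-! ### Right creation operators and commuting right fields. -/

section RightCreation

variable {H : Type u} [NormedAddCommGroup H] [InnerProductSpace ℂ H]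

/-- Right creation is the lift of the left creation operators with starting vector `η` instead of
the vacuum. This vector is not wandering, but it is still orthogonal to all longer words: removing
one letter from each side leaves the vacuum against a vector orthogonal to it. Hence
`exists_fockLift` is needed rather than the wandering version. -/
theorem exists_rightCreation_of_norm_eq_one {η : H} (hη : ‖η‖ = 1) :
    ∃ r : Fock H →L[ℂ] Fock H, r (vacuum H) = creation η (vacuum H) ∧
      ∀ ξ x, r (creation ξ x) = creation ξ (r x) := by
  have hw : ‖creation η (vacuum H)‖ = 1 := by
    rw [norm_creation_apply, hη, norm_vacuum, mul_one]
  obtain ⟨R, hR0, hR⟩ := exists_fockLift isRowIsometry_creationL hw fun ξ n x => by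
    rw [creationL_apply, inner_creation_creation]
    refine mul_eq_zero_of_right _ ?_
    exact powerLift_mem isRowIsometry_creationL hw
      (LinearMap.ker (innerSL ℂ (vacuum H)).toLinearMap)
      (ContinuousLinearMap.isClosed_ker _) (inner_vacuum_creation _ _)
      (fun ξ x => inner_vacuum_creation ξ x) n x
  exact ⟨R.toContinuousLinearMap, hR0, hR⟩

theorem exists_rightCreation (η : H) :
    ∃ r : Fock H →L[ℂ] Fock H, r (vacuum H) = creation η (vacuum H) ∧
      ∀ ξ x, r (creation ξ x) = creation ξ (r x) := by
  by_cases hη : η = 0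
  · subst hη
    refine ⟨0, ?_, by simp⟩
    rw [← creationL_apply, map_zero]
  · have hn : (‖η‖ : ℂ) ≠ 0 := by simpa using hη
    obtain ⟨r, hr0, hr⟩ := exists_rightCreation_of_norm_eq_one (η := (‖η‖⁻¹ : ℂ) • η)
      (by simp [norm_smul, hη])
    refine ⟨(‖η‖ : ℂ) • r, ?_, by simp [hr]⟩
    rw [smul_apply, hr0, creation_smul, smul_apply, smul_smul, mul_inv_cancel₀ hn, one_smul]

/-- The right creation operator `ξ₁ ⊗ ⋯ ⊗ ξₙ ↦ ξ₁ ⊗ ⋯ ⊗ ξₙ ⊗ η`. -/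
def rightCreation (η : H) : Fock H →L[ℂ] Fock H := (exists_rightCreation η).choose

theorem rightCreation_vacuum (η : H) : rightCreation η (vacuum H) = creation η (vacuum H) :=
  (exists_rightCreation η).choose_spec.1

theorem rightCreation_creation (η ξ : H) (x : Fock H) :
    rightCreation η (creation ξ x) = creation ξ (rightCreation η x) :=
  (exists_rightCreation η).choose_spec.2 ξ x

theorem inner_vacuum_rightCreation (η : H) (x : Fock H) :
    ⟪vacuum H, rightCreation η x⟫_ℂ = 0 := by
  have := fock_clm_ext (f := (innerSL ℂ (vacuum H)).comp (rightCreation η)) (g := 0)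
    (by simp [rightCreation_vacuum, inner_vacuum_creation])
    (fun ξ x _ => by simp [rightCreation_creation, inner_vacuum_creation])
  exact congrArg (fun f : Fock H →L[ℂ] ℂ => f x) this

theorem star_rightCreation_vacuum (η : H) : star (rightCreation η) (vacuum H) = 0 :=
  ext_inner_left ℂ fun y => by
    rw [inner_star_apply, inner_zero_right, ← inner_conj_symm, inner_vacuum_rightCreation, map_zero]

theorem inner_star_apply_left {E : Type*} [NormedAddCommGroup E] [InnerProductSpace ℂ E]
    [CompleteSpace E] (f : E →L[ℂ] E) (x y : E) : ⟪star f x, y⟫_ℂ = ⟪x, f y⟫_ℂ :=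
  ContinuousLinearMap.adjoint_inner_left f y x

/-- Left annihilation and right creation act on opposite ends of a word and interfere only on the
vacuum, so their commutator is a multiple of the vacuum projection. -/
theorem star_creation_rightCreation (ξ η : H) (x : Fock H) :
    star (creation ξ) (rightCreation η x) =
      rightCreation η (star (creation ξ) x) + (⟪ξ, η⟫_ℂ * ⟪vacuum H, x⟫_ℂ) • vacuum H := by
  have := fock_clm_ext (f := (star (creation ξ)).comp (rightCreation η))
    (g := (rightCreation η).comp (star (creation ξ)) +
      ⟪ξ, η⟫_ℂ • (innerSL ℂ (vacuum H)).smulRight (vacuum H))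
    (by simp [rightCreation_vacuum, star_creation_creation, star_creation_vacuum,
      norm_vacuum])
    (fun ζ x _ => by
      simp [rightCreation_creation, star_creation_creation, inner_vacuum_creation])
  have h := congrArg (fun f : Fock H →L[ℂ] Fock H => f x) this
  simpa [mul_smul] using h

theorem star_rightCreation_creation (η ξ : H) (x : Fock H) :
    star (rightCreation η) (creation ξ x) =
      creation ξ (star (rightCreation η) x) + (⟪η, ξ⟫_ℂ * ⟪vacuum H, x⟫_ℂ) • vacuum H := by
  refine ext_inner_left ℂ fun y => ?_
  rw [inner_star_apply, inner_add_right, ← inner_star_apply_left (creation ξ),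
    ← inner_star_apply_left (creation ξ), star_creation_rightCreation, inner_add_left,
    ← inner_star_apply (rightCreation η), inner_smul_left, inner_smul_right, map_mul,
    inner_conj_symm, inner_conj_symm]
  ring

theorem star_rightCreation_rightCreation (η ζ : H) (x : Fock H) :
    star (rightCreation η) (rightCreation ζ x) = ⟪η, ζ⟫_ℂ • x := by
  have := fock_clm_ext (f := (star (rightCreation η)).comp (rightCreation ζ))
    (g := ⟪η, ζ⟫_ℂ • ContinuousLinearMap.id ℂ (Fock H))
    (by simp [rightCreation_vacuum, star_rightCreation_creation, star_rightCreation_vacuum,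
      norm_vacuum])
    (fun ξ x hx => by
      simp only [ContinuousLinearMap.comp_apply, smul_apply, ContinuousLinearMap.id_apply] at hx ⊢
      rw [rightCreation_creation, star_rightCreation_creation, hx, inner_vacuum_rightCreation]
      simp)
  exact congrArg (fun f : Fock H →L[ℂ] Fock H => f x) this

/-- The left and right fields of `ξ` and `η` commute if `⟪ξ, η⟫` is real. -/
theorem commute_left_right {ξ η : H} (h : ⟪ξ, η⟫_ℂ = ⟪η, ξ⟫_ℂ) :
    (creation ξ + star (creation ξ)) * (rightCreation η + star (rightCreation η)) =
      (rightCreation η + star (rightCreation η)) * (creation ξ + star (creation ξ)) := by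
  have h' : star (rightCreation η) * star (creation ξ) =
      star (creation ξ) * star (rightCreation η) := by
    rw [← star_mul, ← star_mul]
    exact congrArg star (ContinuousLinearMap.ext fun x => (rightCreation_creation η ξ x).symm)
  ext1 x
  have h'' := congrArg (fun f : Fock H →L[ℂ] Fock H => f x) h'
  simp only [mul_apply_eq_comp, add_apply, map_add, rightCreation_creation,
    star_creation_rightCreation, star_rightCreation_creation, h] at h'' ⊢
  rw [h'']
  abel

/-- The vector `ξ₁ ⊗ ⋯ ⊗ ξₙ` of the Fock space. -/
def fockWord : List H → Fock H
  | [] => vacuum H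
  | ξ :: L => creation ξ (fockWord L)

theorem rightCreation_fockWord (η : H) (L : List H) :
    rightCreation η (fockWord L) = fockWord (L ++ [η]) := by
  induction L with
  | nil => exact rightCreation_vacuum η
  | cons ξ L ih =>
    rw [fockWord, rightCreation_creation, ih]
    rfl

theorem mem_of_forall_fockWord_mem {N : Submodule ℂ (Fock H)} (hN : IsClosed (N : Set (Fock H)))
    (h : ∀ L, fockWord L ∈ N) (x : Fock H) : x ∈ N := by
  have hle : (Submodule.span ℂ (Set.range (fockWord (H := H)))).topologicalClosure ≤ N :=
    Submodule.topologicalClosure_minimal _ (Submodule.span_le.2 (by rintro _ ⟨L, rfl⟩; exact h L))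
      hN
  refine hle (fock_induction (Submodule.isClosed_topologicalClosure _)
    (Submodule.le_topologicalClosure _ (Submodule.subset_span (Set.mem_range_self [])))
    (fun ξ y hy => ?_) x)
  refine map_mem_closure (creation ξ).continuous hy fun y hy => ?_
  induction hy using Submodule.span_induction with
  | mem y hy =>
    obtain ⟨L, rfl⟩ := hy
    exact Submodule.subset_span ⟨ξ :: L, rfl⟩
  | zero => rw [map_zero]; exact Submodule.zero_mem _
  | add y z _ _ hy hz => rw [map_add]; exact Submodule.add_mem _ hy hz
  | smul c y _ hy => rw [map_smul]; exact Submodule.smul_mem _ c hy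

/-- A closed subspace of the Fock space which contains `ξ₁ ⊗ ⋯ ⊗ ξₙ` for all `ξᵢ` in a total set
is the whole space. -/
theorem mem_of_forall_fockWord_mem_of_dense {N : Submodule ℂ (Fock H)}
    (hN : IsClosed (N : Set (Fock H))) {C : Set H}
    (hC : (Submodule.span ℂ C).topologicalClosure = ⊤)
    (h : ∀ L : List H, (∀ η ∈ L, η ∈ C) → fockWord L ∈ N) (x : Fock H) : x ∈ N := by
  have hlin : ∀ L : List H, ∃ f : Fock H →L[ℂ] Fock H,
      ∀ L', fockWord (L ++ L') = f (fockWord L') := by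
    intro L
    induction L with
    | nil => exact ⟨ContinuousLinearMap.id ℂ _, fun L' => rfl⟩
    | cons ξ L ih =>
      obtain ⟨f, hf⟩ := ih
      exact ⟨(creation ξ).comp f, fun L' => congrArg (creation ξ) (hf L')⟩
  refine mem_of_forall_fockWord_mem hN (fun L => ?_) x
  -- Letters in `C` are replaced by arbitrary ones, one at a time: `L'` is a prefix still in `C`,
  -- `L` a tail already arbitrary. The word depends linearly and continuously on each letter.
  suffices ∀ L' : List H, (∀ η ∈ L', η ∈ C) → fockWord (L' ++ L) ∈ N from this [] (by simp)
  induction L with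
  | nil => simpa using h
  | cons ξ L ih =>
    intro L' hL'
    obtain ⟨f, hf⟩ := hlin L'
    let g : H →L[ℂ] Fock H := f.comp (creationL.flip (fockWord L))
    have hg : ∀ ξ, g ξ = fockWord (L' ++ ξ :: L) := fun ξ => (hf (ξ :: L)).symm
    have hle : (Submodule.span ℂ C).topologicalClosure ≤ N.comap g.toLinearMap := by
      refine Submodule.topologicalClosure_minimal _ (Submodule.span_le.2 fun ξ hξ => ?_)
        (hN.preimage g.continuous)
      change g ξ ∈ N
      rw [hg, show L' ++ ξ :: L = (L' ++ [ξ]) ++ L by simp]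
      refine ih _ fun η hη => ?_
      rcases List.mem_append.1 hη with h | h
      · exact hL' η h
      · rw [List.mem_singleton.1 h]
        exact hξ
    rw [hC] at hle
    exact hg ξ ▸ hle (x := ξ) trivial

/-- The vacuum is cyclic for the right fields of a total set of vectors. -/
theorem mem_of_right_invariant {N : Submodule ℂ (Fock H)} (hN : IsClosed (N : Set (Fock H)))
    {C : Set H} (hC : (Submodule.span ℂ C).topologicalClosure = ⊤) (h0 : vacuum H ∈ N)
    (h1 : ∀ η ∈ C, ∀ x ∈ N, (rightCreation η + star (rightCreation η)) x ∈ N) (x : Fock H) :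
    x ∈ N := by
  refine mem_of_forall_fockWord_mem_of_dense hN hC (fun L => ?_) x
  have key : ∀ n, ∀ L : List H, L.length = n → (∀ η ∈ L, η ∈ C) → fockWord L ∈ N := by
    intro n
    induction n using Nat.strong_induction_on with
    | _ n ih =>
      intro L hn hL
      rcases List.eq_nil_or_concat L with rfl | ⟨L, η, rfl⟩
      · exact h0
      · rw [List.concat_eq_append] at *
        have hη : η ∈ C := hL η (by simp)
        have hL1 : fockWord L ∈ N :=
          ih L.length (by simp [← hn]) L rfl fun ζ hζ => hL ζ (by simp [hζ])
        -- The right field of `η` applied to a word appends `η`, up to `r(η)*` of the word. That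
        -- correction is zero or a multiple of the word without its last letter, so strong induction
        -- on the length covers it.
        have h2 := h1 η hη _ hL1
        rw [add_apply, rightCreation_fockWord] at h2
        refine (Submodule.add_mem_iff_left N ?_).1 h2
        rcases List.eq_nil_or_concat L with rfl | ⟨L, ζ, rfl⟩
        · rw [fockWord, star_rightCreation_vacuum]
          exact N.zero_mem
        · rw [List.concat_eq_append] at *
          rw [← rightCreation_fockWord, star_rightCreation_rightCreation]
          exact N.smul_mem _ (ih L.length (by simp [← hn]) L rfl
            fun ζ hζ => hL ζ (by simp [hζ]))
  exact key _ L rfl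

end RightCreation

/-! ### Symplectic complements of closed real subspaces. -/

section Symplectic

open scoped ClosedSubmodule

variable {H : Type u} [NormedAddCommGroup H] [InnerProductSpace ℂ H] [CompleteSpace H]

/-- A vector which is orthogonal to the symplectic complement of a closed real subspace is in this
subspace. -/
theorem mem_of_orthogonal_symplectic {S : Submodule ℝ H} (hS : IsClosed (S : Set H)) {ζ : H}
    (hζ : ∀ η : H, (∀ ξ ∈ S, (⟪ξ, η⟫_ℂ).im = 0) → ⟪ζ, η⟫_ℂ = 0) : ζ ∈ S := by
  have : CompleteSpace S := hS.completeSpace_coe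
  obtain ⟨a, ha, b, hb, rfl⟩ := S.exists_add_mem_mem_orthogonal ζ
  have hb' : ∀ ξ ∈ S, (⟪ξ, b⟫_ℂ).re = 0 := fun ξ hξ => (Submodule.mem_orthogonal _ _).1 hb ξ hξ
  -- Real orthogonality of `b` to `S` means that `i b` is in the symplectic complement. Testing `ζ =
  -- a + b` against it yields `‖b‖² = 0`.
  have h := hζ (Complex.I • b) fun ξ hξ => by
    rw [inner_smul_right, Complex.I_mul_im, hb' ξ hξ]
  rw [inner_smul_right, mul_eq_zero_iff_left Complex.I_ne_zero, inner_add_left] at h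
  have h' := congrArg Complex.re h
  rw [Complex.add_re, hb' a ha, zero_add, Complex.zero_re] at h'
  have : b = 0 := by
    have hn : ‖b‖ ^ 2 = 0 := by rw [← h']; exact (inner_self_eq_norm_sq (𝕜 := ℂ) b).symm
    simpa using hn
  rwa [this, add_zero]

/-- If a closed real subspace `S` satisfies `S ∩ i S = 0`, then its symplectic complement is
total. -/
theorem symplectic_total {S : Submodule ℝ H} (hS : IsClosed (S : Set H))
    (hS' : ∀ ξ ∈ S, Complex.I • ξ ∈ S → ξ = 0) :
    (Submodule.span ℂ {η : H | ∀ ξ ∈ S, (⟪ξ, η⟫_ℂ).im = 0}).topologicalClosure = ⊤ := by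
  rw [Submodule.topologicalClosure_eq_top_iff, Submodule.eq_bot_iff]
  intro ζ hζ
  rw [Submodule.mem_orthogonal'] at hζ
  have h : ∀ η : H, (∀ ξ ∈ S, (⟪ξ, η⟫_ℂ).im = 0) → ⟪ζ, η⟫_ℂ = 0 := fun η hη =>
    hζ η (Submodule.subset_span hη)
  refine hS' ζ (mem_of_orthogonal_symplectic hS h) (mem_of_orthogonal_symplectic hS fun η hη => ?_)
  rw [inner_smul_left, h η hη, mul_zero]

end Symplectic

/-! ### The graph of `A^{-s}` is closed. -/

section ClosedGraph

open Filter Topology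

variable {H : Type u} [NormedAddCommGroup H] [InnerProductSpace ℂ H]

/-- The function `z ↦ A^{-z} p.1` that witnesses `p.2 = A^{-s} p.1`. -/
def IsStripExtension (u : ℝ → H →ₗ[ℂ] H) (s : ℝ) (p : H × H) (F : ℂ → H) : Prop :=
  DiffContOnCl ℂ F (Complex.re ⁻¹' Set.Ioo 0 s) ∧
    BddAbove ((norm ∘ F) '' (Complex.re ⁻¹' Set.Icc 0 s)) ∧
    (∀ t : ℝ, F (t * Complex.I) = u (-t) p.1) ∧ F s = p.2

theorem mem_negPowGraph_iff {u : ℝ → H →ₗ[ℂ] H} {s : ℝ} {p : H × H} :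
    p ∈ negPowGraph u s ↔ ∃ F, IsStripExtension u s p F := Iff.rfl

theorem IsStripExtension.sub {u : ℝ → H →ₗ[ℂ] H} {s : ℝ} {p q : H × H} {F G : ℂ → H}
    (hF : IsStripExtension u s p F) (hG : IsStripExtension u s q G) :
    IsStripExtension u s (p - q) (F - G) := by
  obtain ⟨hF, ⟨C, hC⟩, hF', hF''⟩ := hF
  obtain ⟨hG, ⟨D, hD⟩, hG', hG''⟩ := hG
  refine ⟨hF.sub hG, ⟨C + D, ?_⟩, by simp [hF', hG'], by simp [hF'', hG'']⟩
  rintro _ ⟨z, hz, rfl⟩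
  exact (norm_sub_le _ _).trans
    (add_le_add (hC (Set.mem_image_of_mem _ hz)) (hD (Set.mem_image_of_mem _ hz)))

theorem closure_strip {s : ℝ} (hs : 0 < s) :
    closure (Complex.re ⁻¹' Set.Ioo 0 s) = Complex.re ⁻¹' Set.Icc 0 s := by
  rw [Complex.closure_preimage_re, closure_Ioo hs.ne]

theorem isOpen_strip (s : ℝ) : IsOpen (Complex.re ⁻¹' Set.Ioo 0 s) :=
  isOpen_Ioo.preimage Complex.continuous_re

variable {u : ℝ → H →ₗ[ℂ] H} {s : ℝ}

/-- The group law holds on the imaginary axis and propagates to the opposite edge of the strip by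
uniqueness of the extension. It makes the norm of `F` constant along that edge. -/
theorem IsStripExtension.apply_add {p : H × H} {F : ℂ → H} (hF : IsStripExtension u s p F)
    (hadd : ∀ s t x, u (s + t) x = u s (u t x))
    (hnorm : ∀ t x, ‖u t x‖ = ‖x‖) (hs : 0 < s) (t : ℝ) : F (s + t * Complex.I) = u (-t) p.2 := by
  obtain ⟨hd, ⟨C, hC⟩, h0, h1⟩ := hF
  let U : H →L[ℂ] H := (u (-t)).mkContinuous 1 fun x => by rw [hnorm, one_mul]
  have hshift : ∀ z : ℂ, (z + t * Complex.I).re = z.re := fun z => by simp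
  -- `G` vanishes on the imaginary axis, so `negPowGraph_eq_zero` makes it vanish at `s`.
  let G : ℂ → H := fun z => F (z + t * Complex.I) - U (F z)
  have hG : IsStripExtension u s (0, G s) G := by
    refine ⟨?_, ⟨C + C, ?_⟩, fun τ => ?_, rfl⟩
    · refine DiffContOnCl.sub ?_ (U.differentiable.comp_diffContOnCl hd)
      refine hd.comp (g := fun z : ℂ => z + t * Complex.I)
        (by fun_prop : Differentiable ℂ fun z : ℂ => z + t * Complex.I).diffContOnCl ?_
      intro z hz
      simpa using hz
    · rintro _ ⟨z, hz, rfl⟩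
      have hz' : z + t * Complex.I ∈ Complex.re ⁻¹' Set.Icc 0 s := by simpa using hz
      refine (norm_sub_le _ _).trans (add_le_add (hC (Set.mem_image_of_mem _ hz')) ?_)
      exact (hnorm (-t) (F z)).le.trans (hC (Set.mem_image_of_mem _ hz))
    · change F (τ * Complex.I + t * Complex.I) - u (-t) (F (τ * Complex.I)) = u (-τ) 0
      rw [← add_mul, ← Complex.ofReal_add, h0, h0, ← hadd, map_zero, sub_eq_zero]
      congr 2
      ring
  have := negPowGraph_eq_zero u hs (mem_negPowGraph_iff.2 ⟨G, hG⟩) rfl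
  have h2 : F (s + t * Complex.I) - u (-t) (F s) = 0 := this
  rw [sub_eq_zero.1 h2, h1]

/-- On each edge the norm of `F` is constant, equal to the norm of a component of `p`; the three
lines theorem does the rest. Applied to differences, it turns convergence in the graph into uniform
convergence on the strip. -/
theorem IsStripExtension.norm_le {p : H × H} {F : ℂ → H} (hF : IsStripExtension u s p F)
    (hadd : ∀ s t x, u (s + t) x = u s (u t x))
    (hnorm : ∀ t x, ‖u t x‖ = ‖x‖) (hs : 0 < s) {z : ℂ}
    (hz : z ∈ Complex.re ⁻¹' Set.Icc 0 s) : ‖F z‖ ≤ ‖p‖ := by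
  have h0 : ∀ z ∈ Complex.re ⁻¹' {(0 : ℝ)}, ‖F z‖ ≤ ‖p‖ := by
    intro z hz
    have : z = (z.im : ℂ) * Complex.I := by
      apply Complex.ext <;> simp [show z.re = 0 from hz]
    rw [this, hF.2.2.1, hnorm]
    exact norm_fst_le p
  have h1 : ∀ z ∈ Complex.re ⁻¹' {s}, ‖F z‖ ≤ ‖p‖ := by
    intro z hz
    have : z = s + (z.im : ℂ) * Complex.I := by
      apply Complex.ext <;> simp [show z.re = s from hz]
    rw [this, hF.apply_add hadd hnorm hs, hnorm]
    exact norm_snd_le p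
  have h := Complex.HadamardThreeLines.norm_le_interp_of_mem_verticalClosedStrip' hs hz hF.1 hF.2.1
    h0 h1
  simp only [sub_zero] at h
  have hz' : 0 ≤ z.re / s ∧ z.re / s ≤ 1 := ⟨div_nonneg hz.1 hs.le, (div_le_one hs).2 hz.2⟩
  rwa [← Real.rpow_add_of_nonneg (norm_nonneg p) (by linarith) hz'.1, sub_add_cancel,
    Real.rpow_one] at h

/-- The graph of `A^{-s}` is closed. -/
theorem isClosed_negPowGraph [CompleteSpace H] (hadd : ∀ s t x, u (s + t) x = u s (u t x))
    (hnorm : ∀ t x, ‖u t x‖ = ‖x‖) (hs : 0 < s) :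
    IsClosed (negPowGraph u s : Set (H × H)) := by
  refine IsSeqClosed.isClosed fun p q hp hpq => ?_
  choose F hF using fun n => mem_negPowGraph_iff.1 (hp n)
  have hdist : ∀ m n, ∀ z ∈ Complex.re ⁻¹' Set.Icc 0 s,
      dist (F m z) (F n z) ≤ dist (p m) (p n) := by
    intro m n z hz
    rw [dist_eq_norm, dist_eq_norm]
    exact ((hF m).sub (hF n)).norm_le hadd hnorm hs hz
  have hcau := Metric.cauchySeq_iff.1 hpq.cauchySeq
  have hUC : UniformCauchySeqOn F atTop (Complex.re ⁻¹' Set.Icc 0 s) := by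
    refine Metric.uniformCauchySeqOn_iff.2 fun ε hε => ?_
    obtain ⟨N, hN⟩ := hcau ε hε
    exact ⟨N, fun m hm n hn z hz => (hdist m n z hz).trans_lt (hN m hm n hn)⟩
  have hlim : ∀ z, ∃ y, z ∈ Complex.re ⁻¹' Set.Icc 0 s → Tendsto (fun n => F n z) atTop (𝓝 y) := by
    intro z
    by_cases hz : z ∈ Complex.re ⁻¹' Set.Icc 0 s
    · obtain ⟨y, hy⟩ := cauchySeq_tendsto_of_complete (hUC.cauchySeq hz)
      exact ⟨y, fun _ => hy⟩
    · exact ⟨0, fun h => absurd h hz⟩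
  choose G hG using hlim
  have hTU := hUC.tendstoUniformlyOn_of_tendsto hG
  have hsub : Complex.re ⁻¹' Set.Ioo 0 s ⊆ Complex.re ⁻¹' Set.Icc 0 s :=
    Set.preimage_mono Set.Ioo_subset_Icc_self
  refine mem_negPowGraph_iff.2 ⟨G, ⟨?_, ?_⟩, ⟨‖q‖, ?_⟩, fun t => ?_, ?_⟩
  · exact (hTU.mono hsub).tendstoLocallyUniformlyOn.differentiableOn
      (Eventually.of_forall fun n => (hF n).1.differentiableOn) (isOpen_strip s)
  · rw [closure_strip hs]
    exact hTU.continuousOn (Eventually.of_forall fun n =>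
      closure_strip hs ▸ (hF n).1.continuousOn).frequently
  · rintro _ ⟨z, hz, rfl⟩
    exact le_of_tendsto_of_tendsto' (hG z hz).norm hpq.norm fun n =>
      (hF n).norm_le hadd hnorm hs hz
  · refine tendsto_nhds_unique (hG _ (by simp [hs.le])) ?_
    simp only [(hF _).2.2.1]
    let U : H →L[ℂ] H := (u (-t)).mkContinuous 1 fun x => by rw [hnorm, one_mul]
    exact (U.continuous.tendsto q.1).comp ((continuous_fst.tendsto q).comp hpq)
  · refine tendsto_nhds_unique (hG _ (by simp [hs.le])) ?_
    simp only [(hF _).2.2.2]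
    exact (continuous_snd.tendsto q).comp hpq

end ClosedGraph

/-! ### The real subspace `K_ℝ` and the separating property of the vacuum. -/

section RealSubspace

variable {V : Type u} [NormedAddCommGroup V] [InnerProductSpace ℝ V]

theorem unitaryGroup_add (U : Multiplicative ℝ →* (V ≃ₗᵢ[ℝ] V)) (s t : ℝ) (x : Complexified V) :
    unitaryGroup U (s + t) x = unitaryGroup U s (unitaryGroup U t x) := by
  have h : U (Multiplicative.ofAdd (s + t)) =
      U (Multiplicative.ofAdd s) * U (Multiplicative.ofAdd t) := by
    rw [ofAdd_add, map_mul]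
  unfold unitaryGroup
  rw [h]
  rfl

theorem norm_unitaryGroup (U : Multiplicative ℝ →* (V ≃ₗᵢ[ℝ] V)) (t : ℝ) (x : Complexified V) :
    ‖unitaryGroup U t x‖ = ‖x‖ := by
  refine (sq_eq_sq₀ (norm_nonneg _) (norm_nonneg _)).1 ?_
  rw [Complexified.norm_sq_eq, Complexified.norm_sq_eq]
  congr 2
  · exact LinearIsometryEquiv.norm_map (U (Multiplicative.ofAdd t)) x.re
  · exact LinearIsometryEquiv.norm_map (U (Multiplicative.ofAdd t)) x.im

theorem norm_conjugation (x : Complexified V) : ‖Complexified.conjugation V x‖ = ‖x‖ := by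
  refine (sq_eq_sq₀ (norm_nonneg _) (norm_nonneg _)).1 ?_
  rw [Complexified.norm_sq_eq, Complexified.norm_sq_eq]
  congr 2
  exact norm_neg x.im

theorem conjugation_conjugation (x : Complexified V) :
    Complexified.conjugation V (Complexified.conjugation V x) = x :=
  Complexified.ext rfl (neg_neg x.im)

theorem continuous_conjugation : Continuous (Complexified.conjugation V) :=
  (AddMonoidHomClass.isometry_of_norm (Complexified.conjugation V) norm_conjugation).continuous

/-- As `J² = 1`, the equation `J A^{-1/2} ξ = ξ` says `A^{-1/2} ξ = J ξ`. In this form closedness of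
the graph passes to `K_ℝ`. -/
theorem mem_realSubspace_iff (U : Multiplicative ℝ →* (V ≃ₗᵢ[ℝ] V)) (ξ : Complexified V) :
    ξ ∈ realSubspace U ↔
      (ξ, Complexified.conjugation V ξ) ∈ negPowGraph (unitaryGroup U) (1 / 2) := by
  have hg : ∀ p ∈ negPowGraph (unitaryGroup U) (1 / 2), p.1 = 0 → p.2 = 0 := fun p hp =>
    negPowGraph_eq_zero (unitaryGroup U) (by norm_num) hp
  constructor
  · rintro ⟨h, hξ⟩
    have h1 : (ξ, (invSqrtGenerator U).toFun ⟨ξ, h⟩) ∈ negPowGraph (unitaryGroup U) (1 / 2) :=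
      Submodule.mem_graph_toLinearPMap hg ⟨ξ, h⟩
    have h2 : Complexified.conjugation V ((invSqrtGenerator U).toFun ⟨ξ, h⟩) = ξ := hξ
    rwa [← conjugation_conjugation ((invSqrtGenerator U).toFun ⟨ξ, h⟩), h2] at h1
  · intro h
    have hd : ξ ∈ (invSqrtGenerator U).domain := ⟨_, h, rfl⟩
    refine ⟨hd, ?_⟩
    have h1 : (ξ, (invSqrtGenerator U).toFun ⟨ξ, hd⟩) ∈ negPowGraph (unitaryGroup U) (1 / 2) :=
      Submodule.mem_graph_toLinearPMap hg ⟨ξ, hd⟩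
    have h2 := hg _ (Submodule.sub_mem _ h1 h) (sub_self ξ)
    change Complexified.conjugation V ((invSqrtGenerator U).toFun ⟨ξ, hd⟩) = ξ
    have h3 : (invSqrtGenerator U).toFun ⟨ξ, hd⟩ = Complexified.conjugation V ξ := sub_eq_zero.1 h2
    rw [h3, conjugation_conjugation]

/-- The real subspace `K_ℝ`, as a real-linear subspace. -/
def realSubmodule (U : Multiplicative ℝ →* (V ≃ₗᵢ[ℝ] V)) : Submodule ℝ (Complexified V) where
  carrier := realSubspace U
  zero_mem' := by
    rw [mem_realSubspace_iff, map_zero]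
    exact Submodule.zero_mem _
  add_mem' := by
    intro x y hx hy
    rw [mem_realSubspace_iff] at *
    rw [map_add]
    exact Submodule.add_mem _ hx hy
  smul_mem' := by
    intro c x hx
    rw [mem_realSubspace_iff] at *
    have h := Submodule.smul_mem _ (c : ℂ) hx
    rw [Prod.smul_mk] at h
    have h2 : Complexified.conjugation V ((c : ℂ) • x) =
        (c : ℂ) • Complexified.conjugation V x := by
      rw [map_smulₛₗ, Complex.conj_ofReal]
    rw [← h2] at h
    exact h

theorem isClosed_realSubmodule [CompleteSpace V] (U : Multiplicative ℝ →* (V ≃ₗᵢ[ℝ] V)) :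
    IsClosed (realSubmodule U : Set (Complexified V)) := by
  have h : (realSubmodule U : Set (Complexified V)) =
      (fun ξ => (ξ, Complexified.conjugation V ξ)) ⁻¹'
        (negPowGraph (unitaryGroup U) (1 / 2) : Set (Complexified V × Complexified V)) :=
    Set.ext fun ξ => mem_realSubspace_iff U ξ
  rw [h]
  exact (isClosed_negPowGraph (unitaryGroup_add U) (norm_unitaryGroup U) (by norm_num)).preimage
    (continuous_id.prodMk continuous_conjugation)

/-- `A^{-1/2}` is linear and `J` is conjugate-linear, so `A^{-1/2} (i ξ)` would be both `i J ξ` and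
`-i J ξ`. -/
theorem eq_zero_of_mem_realSubspace {U : Multiplicative ℝ →* (V ≃ₗᵢ[ℝ] V)} {ξ : Complexified V}
    (h : ξ ∈ realSubspace U) (h' : Complex.I • ξ ∈ realSubspace U) : ξ = 0 := by
  rw [mem_realSubspace_iff] at h h'
  have h1 := Submodule.sub_mem _ (Submodule.smul_mem _ Complex.I h) h'
  have h2 := negPowGraph_eq_zero (unitaryGroup U) (by norm_num) h1 (sub_self (Complex.I • ξ))
  have h3 : Complex.I • Complexified.conjugation V ξ -
    Complexified.conjugation V (Complex.I • ξ) = 0 := h2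
  rw [map_smulₛₗ, Complex.conj_I, neg_smul, sub_neg_eq_add, ← two_smul ℂ, smul_smul] at h3
  have h4 : Complexified.conjugation V ξ = 0 :=
    (smul_eq_zero.1 h3).resolve_left (by simp)
  rw [← norm_eq_zero, norm_conjugation, norm_eq_zero] at h4
  exact h4

/-- An operator `T` with `I T I = T` maps `K_ℝ` into itself. -/
theorem CommutesWithInvolution.map_realSubspace {U : Multiplicative ℝ →* (V ≃ₗᵢ[ℝ] V)}
    {T : Complexified V →L[ℂ] Complexified V} (hT : CommutesWithInvolution U T)
    {ξ : Complexified V} (hξ : ξ ∈ realSubspace U) : T ξ ∈ realSubspace U := by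
  obtain ⟨h, hI⟩ := hξ
  obtain ⟨h', hI'⟩ := hT ⟨ξ, h⟩
  simp only [hI] at h' hI'
  exact ⟨h', hI'⟩

theorem star_semicircular (ξ : Complexified V) : star (semicircular ξ) = semicircular ξ := by
  rw [semicircular, star_smul, star_add, star_star, add_comm]
  simp

/-- The vacuum is separating for the free Araki–Woods algebra. -/
theorem vacuumVector_injective [CompleteSpace V] (U : Multiplicative ℝ →* (V ≃ₗᵢ[ℝ] V)) :
    Function.Injective (vacuumVector U) := by
  intro x y hxy
  set z : Fock (Complexified V) →L[ℂ] Fock (Complexified V) := x - y with hz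
  have hzM : z ∈ StarSubalgebra.centralizer ℂ
      (StarSubalgebra.centralizer ℂ (semicircular '' realSubspace U) : Set _) :=
    sub_mem (S := StarSubalgebra ℂ (Fock (Complexified V) →L[ℂ] Fock (Complexified V))) x.2 y.2
  have hcomm : ∀ η : Complexified V, (∀ ξ ∈ realSubmodule U, (⟪ξ, η⟫_ℂ).im = 0) →
      rightCreation η + star (rightCreation η) ∈
        StarSubalgebra.centralizer ℂ (semicircular '' realSubspace U) := by
    intro η hη
    rw [StarSubalgebra.mem_centralizer_iff]
    rintro _ ⟨ξ, hξ, rfl⟩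
    rw [star_semicircular]
    have h : ⟪ξ, η⟫_ℂ = ⟪η, ξ⟫_ℂ := by
      rw [← inner_conj_symm η ξ]
      exact (Complex.conj_eq_iff_im.2 (hη ξ hξ)).symm
    have h' : semicircular ξ * (rightCreation η + star (rightCreation η)) =
        (rightCreation η + star (rightCreation η)) * semicircular ξ := by
      rw [semicircular, smul_mul_assoc, mul_smul_comm, commute_left_right h]
    exact ⟨h', h'⟩
  -- The kernel of `z` contains the vacuum and is stable under the right fields that commute with
  -- `z`, which act cyclically on the vacuum.
  have hzero : ∀ v, v ∈ LinearMap.ker z.toLinearMap := by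
    refine mem_of_right_invariant (ContinuousLinearMap.isClosed_ker z)
      (symplectic_total (isClosed_realSubmodule U) fun ξ h h' => eq_zero_of_mem_realSubspace h h')
      ?_ ?_
    · exact sub_eq_zero.2 hxy
    · intro η hη v hv
      have h := ((StarSubalgebra.mem_centralizer_iff ℂ).1 hzM _ (hcomm η hη)).1
      have h' := congrArg (fun f : Fock (Complexified V) →L[ℂ] Fock (Complexified V) => f v) h
      change z ((rightCreation η + star (rightCreation η)) v) = 0
      have hv' : z v = 0 := hv
      simp only [mul_apply_eq_comp, hv', map_zero] at h'
      exact h'.symm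
  exact Subtype.ext (sub_eq_zero.1 (ContinuousLinearMap.ext hzero))

end RealSubspace

/-! ### First quantization on words. -/

section FirstQuantization

variable {H : Type u} [NormedAddCommGroup H] [InnerProductSpace ℂ H]
variable {K : Type v} [NormedAddCommGroup K] [InnerProductSpace ℂ K]

theorem fockProj_firstQuantization (T : H →L[ℂ] K) (hT : ‖T‖ ≤ 1) (n : ℕ) (x : Fock H) :
    fockProj n (firstQuantization T hT x) = mapPower T n (fockProj n x) := rfl

theorem mapPower_tensorLeft (T : H →L[ℂ] K) (n : ℕ) (ξ : H) (x : TPow H n) :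
    mapPower T (n + 1) (tensorLeft ξ n x) = tensorLeft (T ξ) n (mapPower T n x) :=
  (TensorProduct.mapL T (mapPower T n)).completion_apply_coe (ξ ⊗ₜ[ℂ] x)

theorem mapPower_vacuumZero (T : H →L[ℂ] K) : mapPower T 0 (vacuumZero H) = vacuumZero K := by
  change (EuclideanSpace.single PUnit.unit (1 : ℂ) : Scalars.{u}) PUnit.unit •
    (EuclideanSpace.single PUnit.unit (1 : ℂ) : Scalars.{v}) = EuclideanSpace.single PUnit.unit 1
  simp

theorem firstQuantization_vacuum (T : H →L[ℂ] K) (hT : ‖T‖ ≤ 1) :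
    firstQuantization T hT (vacuum H) = vacuum K := by
  refine fock_ext fun n => ?_
  rw [fockProj_firstQuantization, ← fockIncl_vacuumZero, ← fockIncl_vacuumZero]
  by_cases hn : n = 0
  · subst hn
    rw [fockProj_incl_self, fockProj_incl_self, mapPower_vacuumZero]
  · rw [fockProj_incl_ne hn, fockProj_incl_ne hn, map_zero]

theorem firstQuantization_creation (T : H →L[ℂ] K) (hT : ‖T‖ ≤ 1) (ξ : H) (x : Fock H) :
    firstQuantization T hT (creation ξ x) = creation (T ξ) (firstQuantization T hT x) := by
  refine fock_ext fun n => ?_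
  rw [fockProj_firstQuantization]
  rcases n with _ | n
  · rw [fockProj_zero_creation, fockProj_zero_creation, map_zero]
  · rw [fockProj_succ_creation, fockProj_succ_creation, mapPower_tensorLeft,
      fockProj_firstQuantization]

theorem firstQuantization_fockWord (T : H →L[ℂ] K) (hT : ‖T‖ ≤ 1) (L : List H) :
    firstQuantization T hT (fockWord L) = fockWord (L.map T) := by
  induction L with
  | nil => exact firstQuantization_vacuum T hT
  | cons ξ L ih => rw [fockWord, firstQuantization_creation, ih]; rfl

end FirstQuantization

/-! ### Wick ordered words, existence and uniqueness of `Γ(T)`, Wick polynomials. -/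

section Words

variable {H : Type u} [NormedAddCommGroup H] [InnerProductSpace ℂ H]
variable {K : Type v} [NormedAddCommGroup K] [InnerProductSpace ℂ K]

/-- The operator `ℓ(h₁)* ⋯ ℓ(hₙ)*`. -/
def annihilationWord : List H → Fock H →L[ℂ] Fock H
  | [] => 1
  | ξ :: L => star (creation ξ) * annihilationWord L

/-- The operator `ℓ(a₁) ⋯ ℓ(a_k) ℓ(b₁)* ⋯ ℓ(b_m)*`. -/
def opWord : List H → List H → Fock H →L[ℂ] Fock H
  | [], b => annihilationWord b
  | ξ :: a, b => creation ξ * opWord a b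

theorem coe_wickWord (a b : List H) : (wickWord a b : Fock H →L[ℂ] Fock H) = opWord a b := by
  induction a with
  | nil =>
    induction b with
    | nil => simp [wickWord, opWord, annihilationWord]
    | cons ξ b ih =>
      simp only [wickWord, List.map_nil, List.prod_nil, one_mul, List.map_cons,
        List.prod_cons] at ih ⊢
      exact congrArg (star (creation ξ) * ·) ih
  | cons ξ a ih =>
    simp only [wickWord, List.map_cons, List.prod_cons, mul_assoc] at ih ⊢
    exact congrArg (creation ξ * ·) ih

/-- A linear map `φ` of the operators on Fock spaces is Wick-equivariant over `T` if it is unital,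
`φ (ℓ(ξ) x) = ℓ(T ξ) φ(x)` and `φ (x ℓ(ξ)*) = φ(x) ℓ(T ξ)*`. -/
structure IsWickEquivariant (T : H →L[ℂ] K)
    (φ : (Fock H →L[ℂ] Fock H) →ₗ[ℂ] (Fock K →L[ℂ] Fock K)) : Prop where
  map_one : φ 1 = 1
  map_creation_mul : ∀ ξ x, φ (creation ξ * x) = creation (T ξ) * φ x
  map_mul_star_creation : ∀ ξ x, φ (x * star (creation ξ)) = φ x * star (creation (T ξ))

theorem IsWickEquivariant.map_mul_annihilationWord {T : H →L[ℂ] K}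
    {φ : (Fock H →L[ℂ] Fock H) →ₗ[ℂ] (Fock K →L[ℂ] Fock K)} (hφ : IsWickEquivariant T φ)
    (L : List H) (x : Fock H →L[ℂ] Fock H) :
    φ (x * annihilationWord L) = φ x * annihilationWord (L.map T) := by
  induction L generalizing x with
  | nil => simp [annihilationWord]
  | cons ξ L ih =>
    rw [annihilationWord, ← mul_assoc, ih, hφ.map_mul_star_creation, mul_assoc]
    rfl

theorem IsWickEquivariant.map_annihilationWord {T : H →L[ℂ] K}
    {φ : (Fock H →L[ℂ] Fock H) →ₗ[ℂ] (Fock K →L[ℂ] Fock K)} (hφ : IsWickEquivariant T φ)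
    (L : List H) : φ (annihilationWord L) = annihilationWord (L.map T) := by
  simpa [hφ.map_one] using hφ.map_mul_annihilationWord L 1

theorem IsWickEquivariant.map_opWord {T : H →L[ℂ] K}
    {φ : (Fock H →L[ℂ] Fock H) →ₗ[ℂ] (Fock K →L[ℂ] Fock K)} (hφ : IsWickEquivariant T φ)
    (a b : List H) : φ (opWord a b) = opWord (a.map T) (b.map T) := by
  induction a with
  | nil => exact hφ.map_annihilationWord b
  | cons ξ a ih => rw [opWord, hφ.map_creation_mul, ih]; rfl

/-- Annihilators on the right of `x` pass through `S` by the intertwining relation, creators on its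
left by the adjoint relation. Creators on the right of `x` do not pass, so the compression is in
general not multiplicative. -/
theorem isWickEquivariant_compression {T : H →L[ℂ] K} {I : Type w}
    {S : Fock K →ₗᵢ[ℂ] Amplified I (Fock H)}
    (hS : ∀ ξ x, amplify I (Fock H) (star (creation ξ)) (S x) = S (star (creation (T ξ)) x)) :
    IsWickEquivariant T (compression S.toContinuousLinearMap) where
  map_one := by
    refine ContinuousLinearMap.ext fun z => ext_inner_left ℂ fun y => ?_
    rw [inner_compression, map_one]
    exact S.inner_map_map y z
  map_creation_mul ξ x := by
    refine ContinuousLinearMap.ext fun z => ext_inner_left ℂ fun y => ?_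
    rw [inner_compression, map_mul, mul_apply_eq_comp, mul_apply_eq_comp,
      ← inner_star_apply_left (amplify I (Fock H) (creation ξ)),
      ← inner_star_apply_left (creation (T ξ)), inner_compression, ← map_star]
    simp only [LinearIsometry.coe_toContinuousLinearMap, hS]
  map_mul_star_creation ξ x := by
    refine ContinuousLinearMap.ext fun z => ext_inner_left ℂ fun y => ?_
    rw [inner_compression, map_mul, mul_apply_eq_comp, mul_apply_eq_comp, inner_compression]
    simp only [LinearIsometry.coe_toContinuousLinearMap, hS]

/-- A subspace of an algebra that contains `1` and is stable under left multiplication by a set and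
its adjoints contains the ⋆-algebra generated by the set. -/
theorem mem_of_mem_adjoin_of_left_stable {A : Type*} [Ring A] [StarRing A] [Algebra ℂ A]
    [StarModule ℂ A] {s : Set A} {P : Submodule ℂ A} (h1 : 1 ∈ P) (hs : ∀ g ∈ s, ∀ x ∈ P, g * x ∈ P)
    (hs' : ∀ g ∈ s, ∀ x ∈ P, star g * x ∈ P) {a : A} (ha : a ∈ StarAlgebra.adjoin ℂ s) : a ∈ P := by
  suffices h : ∀ x ∈ P, a * x ∈ P by simpa using h 1 h1
  change a ∈ Algebra.adjoin ℂ (s ∪ star s) at ha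
  induction ha using Algebra.adjoin_induction with
  | mem g hg =>
    rcases hg with hg | hg
    · exact hs g hg
    · exact star_star g ▸ hs' _ hg
  | algebraMap c =>
    intro x hx
    rw [← Algebra.smul_def]
    exact P.smul_mem c hx
  | add a b _ _ iha ihb => exact fun x hx => add_mul a b x ▸ P.add_mem (iha x hx) (ihb x hx)
  | mul a b _ _ iha ihb => exact fun x hx => mul_assoc a b x ▸ iha _ (ihb x hx)

/-- An annihilator to the left of a word either cancels against its first creator to a scalar, or
joins the annihilators if there is no creator; so the span of the words is stable under left
multiplication. -/
theorem adjoin_le_span_opWord {x : Fock H →L[ℂ] Fock H}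
    (hx : x ∈ StarAlgebra.adjoin ℂ (Set.range (creation (H := H)))) :
    x ∈ Submodule.span ℂ (Set.range fun p : List H × List H => opWord p.1 p.2) := by
  have hmem : ∀ a b : List H, opWord a b ∈
      Submodule.span ℂ (Set.range fun p : List H × List H => opWord p.1 p.2) := fun a b =>
    Submodule.subset_span ⟨(a, b), rfl⟩
  refine mem_of_mem_adjoin_of_left_stable (hmem [] []) ?_ ?_ hx
  · rintro _ ⟨ξ, rfl⟩ x hx
    induction hx using Submodule.span_induction with
    | mem x hx => obtain ⟨⟨a, b⟩, rfl⟩ := hx; exact hmem (ξ :: a) b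
    | zero => rw [mul_zero]; exact Submodule.zero_mem _
    | add x y _ _ hx hy => rw [mul_add]; exact Submodule.add_mem _ hx hy
    | smul c x _ hx => rw [mul_smul_comm]; exact Submodule.smul_mem _ c hx
  · rintro _ ⟨ξ, rfl⟩ x hx
    induction hx using Submodule.span_induction with
    | mem x hx =>
      obtain ⟨⟨a, b⟩, rfl⟩ := hx
      rcases a with _ | ⟨η, a⟩
      · exact hmem [] (ξ :: b)
      · change star (creation ξ) * (creation η * opWord a b) ∈ _
        rw [← mul_assoc, star_creation_mul_creation, smul_mul_assoc, one_mul]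
        exact Submodule.smul_mem _ _ (hmem a b)
    | zero => rw [mul_zero]; exact Submodule.zero_mem _
    | add x y _ _ hx hy => rw [mul_add]; exact Submodule.add_mem _ hx hy
    | smul c x _ hx => rw [mul_smul_comm]; exact Submodule.smul_mem _ c hx

/-- A closed subspace of operators which contains all words contains the Toeplitz algebra. -/
theorem mem_of_mem_toeplitz {P : Submodule ℂ (Fock H →L[ℂ] Fock H)}
    (hP : IsClosed (P : Set (Fock H →L[ℂ] Fock H))) (h : ∀ a b, opWord a b ∈ P)
    {x : Fock H →L[ℂ] Fock H} (hx : x ∈ toeplitz H) : x ∈ P := by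
  refine closure_minimal (fun y hy => ?_) hP hx
  exact Submodule.span_le.2 (by rintro _ ⟨p, rfl⟩; exact h p.1 p.2) (adjoin_le_span_opWord hy)

theorem IsWickEquivariant.map_toeplitz {T : H →L[ℂ] K}
    {φ : (Fock H →L[ℂ] Fock H) →ₗ[ℂ] (Fock K →L[ℂ] Fock K)} (hφ : IsWickEquivariant T φ)
    (hc : Continuous φ) {x : Fock H →L[ℂ] Fock H} (hx : x ∈ toeplitz H) : φ x ∈ toeplitz K := by
  refine mem_of_mem_toeplitz (P := (toeplitz K).toSubalgebra.toSubmodule.comap φ)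
    (IsClosed.preimage hc (inferInstance : IsClosed (toeplitz K : Set (Fock K →L[ℂ] Fock K))))
    (fun a b => ?_) hx
  change φ (opWord a b) ∈ toeplitz K
  rw [hφ.map_opWord, ← coe_wickWord]
  exact (wickWord _ _).2

/-- The linear map underlying a completely positive map. -/
def CPMap.linearMap {A : Type u} {B : Type v} [CStarAlgebra A] [CStarAlgebra B] (G : CPMap A B) :
    A →ₗ[ℂ] B :=
  letI := CStarAlgebra.spectralOrder A
  letI := CStarAlgebra.spectralOrder B
  haveI := CStarAlgebra.spectralOrderedRing A
  haveI := CStarAlgebra.spectralOrderedRing B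
  G.toLinearMap

/-- A second quantization is the restriction of every continuous Wick-equivariant map. -/
theorem IsSecondQuantization.coe_eq {T : H →L[ℂ] K} {G : CPMap (toeplitz H) (toeplitz K)}
    (hG : IsSecondQuantization T G)
    {φ : (Fock H →L[ℂ] Fock H) →ₗ[ℂ] (Fock K →L[ℂ] Fock K)} (hφ : IsWickEquivariant T φ)
    (hc : Continuous φ) (x : toeplitz H) : (G x : Fock K →L[ℂ] Fock K) = φ x := by
  let f : toeplitz H →ₗ[ℂ] (Fock K →L[ℂ] Fock K) :=
    (toeplitz K).subtype.toAlgHom.toLinearMap.comp (CPMap.linearMap G)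
  let g : toeplitz H →ₗ[ℂ] (Fock K →L[ℂ] Fock K) :=
    φ.comp (toeplitz H).subtype.toAlgHom.toLinearMap
  have hf : Continuous f := continuous_subtype_val.comp (CPMap.continuous G)
  have hg : Continuous g := hc.comp continuous_subtype_val
  have hclemb : Topology.IsClosedEmbedding (Subtype.val : toeplitz H → Fock H →L[ℂ] Fock H) :=
    (inferInstance : IsClosed (toeplitz H : Set (Fock H →L[ℂ] Fock H))).isClosedEmbedding_subtypeVal
  -- The density statement concerns subspaces of all bounded operators, so the equalizer is pushed
  -- forward along the inclusion of the Toeplitz algebra, a closed embedding.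
  have hx := mem_of_mem_toeplitz
    (P := (LinearMap.eqLocus f g).map (toeplitz H).subtype.toAlgHom.toLinearMap)
    (hclemb.isClosedMap _ (isClosed_eq hf hg)) (fun a b => ?_) x.2
  · obtain ⟨y, hy, hyx⟩ := hx
    have : y = x := Subtype.ext hyx
    exact this ▸ hy
  · refine ⟨wickWord a b, ?_, coe_wickWord a b⟩
    change (G (wickWord a b) : Fock K →L[ℂ] Fock K) = φ (wickWord a b)
    rw [hG.map_word, coe_wickWord, coe_wickWord, hφ.map_opWord]

/-- Existence and uniqueness of the second quantization of a contraction. -/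
theorem existsUnique_secondQuantization [CompleteSpace H] [CompleteSpace K] (T : H →L[ℂ] K)
    (hT : ‖T‖ ≤ 1) : ∃! G : CPMap (toeplitz H) (toeplitz K), IsSecondQuantization T G := by
  obtain ⟨I, S, hS⟩ := exists_stinespring T hT
  have hφ := isWickEquivariant_compression hS
  have hc := continuous_compression S.toContinuousLinearMap
  let G := compressionCP S.toContinuousLinearMap (toeplitz H) (toeplitz K) fun x hx =>
    hφ.map_toeplitz hc hx
  refine ⟨G, ⟨Subtype.ext hφ.map_one, fun a b => Subtype.ext ?_⟩, fun G' hG' => ?_⟩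
  · change compression S.toContinuousLinearMap (wickWord a b) = _
    rw [coe_wickWord, coe_wickWord, hφ.map_opWord]
  · exact DFunLike.ext _ _ fun x => Subtype.ext (hG'.coe_eq hφ hc x)

/-- The Wick polynomial `∑ₖ ℓ(ξ₁) ⋯ ℓ(ξₖ) ℓ(ξₖ₊₁)* ⋯ ℓ(ξₙ)*`. -/
def wickPoly : List H → Fock H →L[ℂ] Fock H
  | [] => 1
  | ξ :: L => creation ξ * wickPoly L + annihilationWord (ξ :: L)

theorem IsWickEquivariant.map_wickPoly {T : H →L[ℂ] K}
    {φ : (Fock H →L[ℂ] Fock H) →ₗ[ℂ] (Fock K →L[ℂ] Fock K)} (hφ : IsWickEquivariant T φ)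
    (L : List H) : φ (wickPoly L) = wickPoly (L.map T) := by
  induction L with
  | nil => exact hφ.map_one
  | cons ξ L ih =>
    rw [wickPoly, map_add, hφ.map_creation_mul, ih, hφ.map_annihilationWord]
    rfl

theorem annihilationWord_cons_vacuum (ξ : H) (L : List H) :
    annihilationWord (ξ :: L) (vacuum H) = 0 := by
  induction L generalizing ξ with
  | nil => exact star_creation_vacuum ξ
  | cons η L ih =>
    rw [annihilationWord, mul_apply_eq_comp, ih, map_zero]

theorem wickPoly_vacuum (L : List H) : wickPoly L (vacuum H) = fockWord L := by
  induction L with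
  | nil => rfl
  | cons ξ L ih =>
    rw [wickPoly, add_apply, mul_apply_eq_comp, ih, annihilationWord_cons_vacuum, add_zero,
      fockWord]

theorem field_mul_wickPoly_nil (ξ : H) :
    (creation ξ + star (creation ξ)) * wickPoly [] = wickPoly [ξ] := by
  simp [wickPoly, annihilationWord]

/-- A three-term recursion of Chebyshev type. Of the terms of `wickPoly (η :: L)`, those starting
with `ℓ(η)` contract with `ℓ(ξ)*`, and the pure annihilation term supplies the one missing in
`wickPoly (ξ :: η :: L)`. -/
theorem field_mul_wickPoly_cons (ξ η : H) (L : List H) :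
    (creation ξ + star (creation ξ)) * wickPoly (η :: L) =
      wickPoly (ξ :: η :: L) + ⟪ξ, η⟫_ℂ • wickPoly L := by
  have h1 : wickPoly (ξ :: η :: L) =
      creation ξ * wickPoly (η :: L) + star (creation ξ) * annihilationWord (η :: L) := rfl
  have h2 : wickPoly (η :: L) = creation η * wickPoly L + annihilationWord (η :: L) := rfl
  have h3 : star (creation ξ) * (creation η * wickPoly L) = ⟪ξ, η⟫_ℂ • wickPoly L := by
    rw [← mul_assoc, star_creation_mul_creation, smul_mul_assoc, one_mul]
  rw [h1, add_mul, add_assoc]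
  congr 1
  rw [h2, mul_add, h3, add_comm]

end Words

theorem coe_starSubalgebra_inclusion {A : Type*} [Semiring A] [StarRing A] [Algebra ℂ A]
    [StarModule ℂ A] {B C : StarSubalgebra ℂ A} (h : B ≤ C) (x : B) :
    (StarSubalgebra.inclusion h x : A) = x := rfl

/-! ### The action of `Γ(T)` on the free Araki–Woods algebra. -/

section FreeArakiWoods

variable {V : Type u} [NormedAddCommGroup V] [InnerProductSpace ℝ V]

theorem two_smul_semicircular (ξ : Complexified V) :
    (2 : ℂ) • semicircular ξ = creation ξ + star (creation ξ) := by
  rw [semicircular, smul_smul]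
  norm_num

/-- The Wick polynomials in vectors of a set are in the algebra generated by the fields. -/
theorem wickPoly_mem_adjoin {C : Set (Complexified V)} (L : List (Complexified V))
    (hL : ∀ ξ ∈ L, ξ ∈ C) : wickPoly L ∈ StarAlgebra.adjoin ℂ (semicircular '' C) := by
  have hfield : ∀ ξ ∈ C,
      creation ξ + star (creation ξ) ∈ StarAlgebra.adjoin ℂ (semicircular '' C) :=
    fun ξ hξ => two_smul_semicircular ξ ▸
      SMulMemClass.smul_mem _ (StarAlgebra.subset_adjoin ℂ _ ⟨ξ, hξ, rfl⟩)
  -- The recursion goes back two steps, so membership is carried for two consecutive lengths.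
  suffices h : wickPoly L ∈ StarAlgebra.adjoin ℂ (semicircular '' C) ∧
      ∀ ξ ∈ C, wickPoly (ξ :: L) ∈ StarAlgebra.adjoin ℂ (semicircular '' C) from h.1
  induction L with
  | nil =>
    refine ⟨one_mem _, fun ξ hξ => ?_⟩
    rw [← field_mul_wickPoly_nil]
    exact mul_mem (hfield ξ hξ) (one_mem _)
  | cons η L ih =>
    obtain ⟨h1, h2⟩ := ih fun ξ hξ => hL ξ (by simp [hξ])
    have h3 := h2 η (hL η (by simp))
    refine ⟨h3, fun ξ hξ => ?_⟩
    rw [← sub_eq_of_eq_add (field_mul_wickPoly_cons ξ η L)]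
    exact sub_mem (mul_mem (hfield ξ hξ) h3) (SMulMemClass.smul_mem _ h1)

/-- The algebra generated by the fields of a set is spanned by the Wick polynomials. -/
theorem mem_span_wickPoly {C : Set (Complexified V)}
    {x : Fock (Complexified V) →L[ℂ] Fock (Complexified V)}
    (hx : x ∈ StarAlgebra.adjoin ℂ (semicircular '' C)) :
    x ∈ Submodule.span ℂ (wickPoly '' {L : List (Complexified V) | ∀ ξ ∈ L, ξ ∈ C}) := by
  set P := Submodule.span ℂ (wickPoly '' {L : List (Complexified V) | ∀ ξ ∈ L, ξ ∈ C})
  have hmem : ∀ L : List (Complexified V), (∀ ξ ∈ L, ξ ∈ C) → wickPoly L ∈ P := fun L hL =>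
    Submodule.subset_span ⟨L, hL, rfl⟩
  have hstable : ∀ ξ ∈ C, ∀ x ∈ P, semicircular ξ * x ∈ P := by
    intro ξ hξ x hx
    induction hx using Submodule.span_induction with
    | mem x hx =>
      obtain ⟨L, hL, rfl⟩ := hx
      rw [semicircular, smul_mul_assoc]
      refine P.smul_mem _ ?_
      rcases L with _ | ⟨η, L⟩
      · rw [field_mul_wickPoly_nil]
        exact hmem _ (by simpa using hξ)
      · rw [field_mul_wickPoly_cons]
        refine P.add_mem (hmem _ fun ζ hζ => ?_)
          (P.smul_mem _ (hmem L fun ζ hζ => hL ζ (by simp [hζ])))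
        rcases List.mem_cons.1 hζ with rfl | h
        · exact hξ
        · exact hL ζ h
    | zero => rw [mul_zero]; exact P.zero_mem
    | add x y _ _ hx hy => rw [mul_add]; exact P.add_mem hx hy
    | smul c x _ hx => rw [mul_smul_comm]; exact P.smul_mem c hx
  refine mem_of_mem_adjoin_of_left_stable (hmem [] (by simp)) ?_ ?_ hx
  · rintro _ ⟨ξ, hξ, rfl⟩
    exact hstable ξ hξ
  · rintro _ ⟨ξ, hξ, rfl⟩
    rw [star_semicircular]
    exact hstable ξ hξ

variable {U : Multiplicative ℝ →* (V ≃ₗᵢ[ℝ] V)} {T : Complexified V →L[ℂ] Complexified V}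
  {φ : (Fock (Complexified V) →L[ℂ] Fock (Complexified V)) →ₗ[ℂ]
    (Fock (Complexified V) →L[ℂ] Fock (Complexified V))}

/-- By linearity only Wick polynomials in letters of `K_ℝ` matter. For these `φ` replaces each
letter by its image under `T`, which stays in `K_ℝ`, and the first quantization does the same to the
word obtained from the vacuum. -/
theorem IsWickEquivariant.map_adjoin (hφ : IsWickEquivariant T φ) (hTU : CommutesWithInvolution U T)
    (hT : ‖T‖ ≤ 1) {x : Fock (Complexified V) →L[ℂ] Fock (Complexified V)}
    (hx : x ∈ StarAlgebra.adjoin ℂ (semicircular '' realSubspace U)) :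
    φ x ∈ StarAlgebra.adjoin ℂ (semicircular '' realSubspace U) ∧
      φ x (vacuum (Complexified V)) = firstQuantization T hT (x (vacuum (Complexified V))) := by
  have hx' := mem_span_wickPoly hx
  clear hx
  induction hx' using Submodule.span_induction with
  | mem x hx =>
    obtain ⟨L, hL, rfl⟩ := hx
    rw [hφ.map_wickPoly, wickPoly_vacuum, wickPoly_vacuum, firstQuantization_fockWord]
    refine ⟨wickPoly_mem_adjoin _ fun ξ hξ => ?_, rfl⟩
    obtain ⟨η, hη, rfl⟩ := List.mem_map.1 hξ
    exact hTU.map_realSubspace (hL η hη)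
  | zero =>
    rw [map_zero]
    exact ⟨zero_mem _, by simp⟩
  | add x y _ _ hx hy =>
    rw [map_add]
    exact ⟨add_mem hx.1 hy.1, by rw [add_apply, add_apply, hx.2, hy.2, map_add]⟩
  | smul c x _ hx =>
    rw [map_smul]
    exact ⟨SMulMemClass.smul_mem c hx.1, by rw [smul_apply, smul_apply, hx.2, map_smul]⟩

theorem IsWickEquivariant.map_arakiWoodsCStar (hφ : IsWickEquivariant T φ) (hc : Continuous φ)
    (hTU : CommutesWithInvolution U T) (hT : ‖T‖ ≤ 1)
    {x : Fock (Complexified V) →L[ℂ] Fock (Complexified V)} (hx : x ∈ arakiWoodsCStar U) :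
    φ x ∈ arakiWoodsCStar U :=
  map_mem_closure hc hx fun _ hy => (hφ.map_adjoin hTU hT hy).1

/-- After pairing with a vector `ζ`, both sides are normal functionals of `x` that agree on the
⋆-algebra generated by the fields. -/
theorem compression_vacuum [CompleteSpace V] {I : Type w}
    {S : Fock (Complexified V) →ₗᵢ[ℂ] Amplified I (Fock (Complexified V))}
    (hφ : IsWickEquivariant T (compression S.toContinuousLinearMap))
    (hTU : CommutesWithInvolution U T) (hT : ‖T‖ ≤ 1)
    {x : Fock (Complexified V) →L[ℂ] Fock (Complexified V)}
    (hx : x ∈ (arakiWoods U).toStarSubalgebra) :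
    compression S.toContinuousLinearMap x (vacuum (Complexified V)) =
      firstQuantization T hT (x (vacuum (Complexified V))) := by
  classical
  -- The functional of the first quantization is written on the amplified space using a single
  -- coordinate, so an index is needed; one exists because `S` is isometric on a nonzero space.
  have hI : Nonempty I := by
    by_contra h
    rw [not_nonempty_iff] at h
    have h0 : S (vacuum (Complexified V)) = 0 := lp.ext (funext fun i => h.elim i)
    have h1 := S.norm_map (vacuum (Complexified V))
    rw [h0, norm_zero, norm_vacuum] at h1
    exact zero_ne_one h1
  obtain ⟨i⟩ := hI
  refine ext_inner_left ℂ fun ζ => ?_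
  have hform : ∀ a : Fock (Complexified V) →L[ℂ] Fock (Complexified V),
      ⟪ζ, firstQuantization T hT (a (vacuum (Complexified V)))⟫_ℂ =
        ⟪(lp.single 2 i (star (firstQuantization T hT) ζ) : Amplified I (Fock (Complexified V))),
          amplify I (Fock (Complexified V)) a (lp.single 2 i (vacuum (Complexified V)))⟫_ℂ := by
    intro a
    rw [lp.inner_single_left, amplify_apply, lp.single_apply_self, inner_star_apply_left]
  rw [hform, inner_compression]
  refine inner_amplify_eq_of_mem_bicommutant _ (mem_bicommutant_adjoin hx) fun a ha => ?_
  rw [← hform, ← inner_compression, (hφ.map_adjoin hTU hT ha).2]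

theorem isNormal_of_compression {E : Type u} [NormedAddCommGroup E] [InnerProductSpace ℂ E]
    [CompleteSpace E] {F : Type v} [NormedAddCommGroup F] [InnerProductSpace ℂ F] [CompleteSpace F]
    {I : Type w} (S : F →L[ℂ] Amplified I E) {M : VonNeumannAlgebra E} {N : VonNeumannAlgebra F}
    {Φ : M.toStarSubalgebra → N.toStarSubalgebra}
    (hΦ : ∀ x, (Φ x : F →L[ℂ] F) = compression S x) : IsNormal Φ := by
  refine continuous_induced_rng.2 ?_
  have h : Subtype.val ∘ Φ = compression S ∘ Subtype.val := funext hΦ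
  rw [h]
  exact @Continuous.comp _ _ _ ((sigmaWeak E).induced Subtype.val) (sigmaWeak E) (sigmaWeak F) _ _
    (continuous_sigmaWeak_compression S) continuous_induced_dom

/-- The compression of the free Araki–Woods algebra implementing `T`. -/
theorem exists_compression_arakiWoods [CompleteSpace V] {I : Type w}
    {S : Fock (Complexified V) →ₗᵢ[ℂ] Amplified I (Fock (Complexified V))}
    (hφ : IsWickEquivariant T (compression S.toContinuousLinearMap))
    (hTU : CommutesWithInvolution U T) (hT : ‖T‖ ≤ 1) :
    ∃ Φ : CPMap (arakiWoods U).toStarSubalgebra (arakiWoods U).toStarSubalgebra,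
      ∀ x, (Φ x : Fock (Complexified V) →L[ℂ] Fock (Complexified V)) =
        compression S.toContinuousLinearMap x := by
  have hM : ∀ x ∈ (arakiWoods U).toStarSubalgebra,
      compression S.toContinuousLinearMap x ∈ (arakiWoods U).toStarSubalgebra := fun _ hx =>
    compression_mem_of_forall_adjoin _ (fun _ ha => arakiWoodsCStar_le_arakiWoods U
      (StarSubalgebra.le_topologicalClosure _ (hφ.map_adjoin hTU hT ha).1)) hx
  exact ⟨_, compressionCP_apply S.toContinuousLinearMap _ _ hM⟩

theorem wickOp_vacuumVector [CompleteSpace V] (x : (arakiWoods U).toStarSubalgebra) :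
    wickOp U (vacuumVector U x) = x :=
  Function.leftInverse_invFun (vacuumVector_injective U) x

end FreeArakiWoods

end ArakiWoods

end

/-! ### The main theorem. -/

theorem mainTheorem8
    {H K : Type*}
    [NormedAddCommGroup H] [InnerProductSpace ℂ H] [CompleteSpace H]
    [NormedAddCommGroup K] [InnerProductSpace ℂ K] [CompleteSpace K]
    {V : Type*} [NormedAddCommGroup V] [InnerProductSpace ℝ V] [CompleteSpace V]
    (U : Multiplicative ℝ →* (V ≃ₗᵢ[ℝ] V))
    (hU : ∀ v : V, Continuous fun t : ℝ => U (Multiplicative.ofAdd t) v) :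
    (∀ T : H →L[ℂ] K, ‖T‖ ≤ 1 →
      ∃! G : CPMap (toeplitz H) (toeplitz K), IsSecondQuantization T G) ∧
    Function.Injective (vacuumVector U) ∧
    (∀ (T : Complexified V →L[ℂ] Complexified V) (hT : ‖T‖ ≤ 1), CommutesWithInvolution U T →
      ∀ G : CPMap (toeplitz (Complexified V)) (toeplitz (Complexified V)),
        IsSecondQuantization T G →
        (∀ x : arakiWoodsCStar U,
          (G (StarSubalgebra.inclusion (arakiWoodsCStar_le_toeplitz U) x) :
            Fock (Complexified V) →L[ℂ] Fock (Complexified V)) ∈ arakiWoodsCStar U) ∧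
        ∃ Φ : CPMap (arakiWoods U).toStarSubalgebra (arakiWoods U).toStarSubalgebra,
          IsNormal Φ ∧
          (∀ x : arakiWoodsCStar U,
            (Φ (StarSubalgebra.inclusion (arakiWoodsCStar_le_arakiWoods U) x) :
              Fock (Complexified V) →L[ℂ] Fock (Complexified V)) =
              G (StarSubalgebra.inclusion (arakiWoodsCStar_le_toeplitz U) x)) ∧
          ∀ ξ ∈ Set.range (vacuumVector U),
            firstQuantization T hT ξ ∈ Set.range (vacuumVector U) ∧
            Φ (wickOp U ξ) = wickOp U (firstQuantization T hT ξ)) := by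
  refine ⟨existsUnique_secondQuantization, vacuumVector_injective U, ?_⟩
  intro T hT hTU G hG
  obtain ⟨I, S, hS⟩ := exists_stinespring T hT
  have hφ := isWickEquivariant_compression hS
  have hc := continuous_compression S.toContinuousLinearMap
  obtain ⟨Φ, hΦ⟩ := exists_compression_arakiWoods hφ hTU hT
  refine ⟨fun x => ?_, Φ, isNormal_of_compression _ hΦ, fun x => ?_, ?_⟩
  · rw [hG.coe_eq hφ hc, coe_starSubalgebra_inclusion]
    exact hφ.map_arakiWoodsCStar hc hTU hT x.2
  · rw [hG.coe_eq hφ hc, hΦ, coe_starSubalgebra_inclusion, coe_starSubalgebra_inclusion]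
  · rintro _ ⟨y, rfl⟩
    -- Since `W(y Ω) = y` by the separating property, this identity of vectors is already the
    -- identity of operators.
    have h : vacuumVector U (Φ y) = firstQuantization T hT (vacuumVector U y) := by
      rw [vacuumVector, hΦ, compression_vacuum hφ hTU hT y.2, vacuumVector]
    refine ⟨⟨Φ y, h⟩, ?_⟩
    rw [← h, wickOp_vacuumVector, wickOp_vacuumVector]
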